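/- Let $\hbar\in\mathbb R$ and let $A_\hbar=C(\mathbb T)\rtimes_\hbar\mathbb Z$ be the rotation algebra ($\mathbb T=\mathbb R/\mathbb Z$), i.e. the universal C*-algebra generated by unitaries $U,V$ with $UV=e^{2\pi i\hbar}VU$. Let $A_\hbar^\infty\subset A_\hbar$ be the set of all sums $\sum_{n,m\in\mathbb Z}c_{nm}U^nV^m$ with $\sum|c_{nm}|(1+n^2+m^2)^k<\infty$ for every $k\in\mathbb N$, let $\tau$ be the standard trace on $A_\hbar$ (so $\tau(\sum c_{nm}U^nV^m)=c_{00}$), and let $\pi_\hbar:A_\hbar\to\mathbb B(L^2(\mathbb R))$ be the representation with $(\pi_\hbar(U)\xi)(x)=e^{2\pi i x}\xi(x)$ and $(\pi_\hbar(V)\xi)(x)=\xi(x-\hbar)$. Let $H=-\frac{d^2}{dx^2}+x^2$ be the harmonic oscillator on $L^2(\mathbb R)$, which is diagonal in the orthonormal basis of Hermite functions with eigenvalues $1,3,5,\dots$. (a) For every $a\in A_\hbar^\infty$ the operator $\pi_\hbar(a)H^{-s}$ is trace class for $\mathrm{Re}(s)>1$, and the function $s\mapsto\mathrm{Tr}(\pi_\hbar(a)H^{-s})$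 on this half-plane extends to a meromorphic function on $\mathbb C$ that is holomorphic on $\mathbb C\setminus\{1\}$ and has at most a simple pole at $s=1$. If $\hbar\neq0$, then $$\mathrm{Res}_{s=1}\,\mathrm{Tr}(\pi_\hbar(a)H^{-s})=\tfrac12\,\tau(a),$$ and $s=1$ is a (simple) pole if and only if $\tau(a)\ne0$. (b) For every bounded uniformly continuous function $f:\mathbb R\to\mathbb C$ and every real $\alpha\neq0$, with $(U_\alpha\xi)(x)=\xi(x-\alpha)$, the operator $fU_\alpha H^{-s}$ is trace class for $\mathrm{Re}(s)>1$, and $s\mapsto\mathrm{Tr}(fU_\alpha H^{-s})$ extends to an entire function. -/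

import Mathlib

open MeasureTheory Filter Topology Complex
open scoped ENNReal SchwartzMap

noncomputable section

namespace Heisenberg

/-! ### The Hilbert space `L²(ℝ)`, multiplication and translation operators -/

/-- The Hilbert space `L²(ℝ)` of complex-valued functions. -/
abbrev L2R : Type := Lp ℂ 2 (volume : Measure ℝ)

/-- The bounded operators on `L²(ℝ)`. -/
abbrev Op : Type := L2R →L[ℂ] L2R

instance instNontrivialL2R : Nontrivial L2R := by
  refine ⟨⟨indicatorConstLp 2 (measurableSet_Ico (a := (0 : ℝ)) (b := 1)) (by simp) (1 : ℂ), 0, ?_⟩⟩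
  intro h
  have := congrArg norm h
  rw [norm_indicatorConstLp (by simp) (by simp)] at this
  simp at this

/-- The operator `ξ ↦ f ξ` of multiplication by an essentially bounded function `f`. -/
def mulOp (f : ℝ → ℂ) (hf : MemLp f ∞ volume) : Op :=
  (ContinuousLinearMap.mul ℂ ℂ).holderL volume ∞ 2 2 (hf.toLp f)

theorem coeFn_mulOp (f : ℝ → ℂ) (hf : MemLp f ∞ volume) (ξ : L2R) :
    mulOp f hf ξ =ᵐ[volume] fun x => f x * ξ x := by
  have h := (ContinuousLinearMap.mul ℂ ℂ).coeFn_holder (r := 2) (hf.toLp f) ξ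
  filter_upwards [h, hf.coeFn_toLp] with x hx hx'
  rw [← hx']
  exact hx

theorem memLp_boundedContinuous (f : BoundedContinuousFunction ℝ ℂ) :
    MemLp (fun x => f x) ∞ (volume : Measure ℝ) :=
  memLp_top_of_bound f.continuous.aestronglyMeasurable ‖f‖
    (Eventually.of_forall fun x => f.norm_coe_le_norm x)

theorem memLp_phase (g : ℝ → ℝ) (hg : Measurable g) :
    MemLp (fun x => exp (2 * Real.pi * g x * I)) ∞ (volume : Measure ℝ) := by
  refine memLp_top_of_bound (by fun_prop) 1 (Eventually.of_forall fun x => ?_)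
  have := Complex.norm_exp_ofReal_mul_I (2 * Real.pi * g x)
  push_cast at this
  exact this.le

theorem phase_inv_aux (g : ℝ → ℝ) (hg : Measurable g) (ξ : L2R) :
    mulOp _ (memLp_phase (fun x => -g x) hg.neg) (mulOp _ (memLp_phase g hg) ξ) = ξ := by
  refine Lp.ext ?_
  filter_upwards [coeFn_mulOp _ (memLp_phase (fun x => -g x) hg.neg)
    (mulOp _ (memLp_phase g hg) ξ), coeFn_mulOp _ (memLp_phase g hg) ξ] with x h1 h2
  rw [h1, h2, ← mul_assoc, ← exp_add]
  push_cast
  ring_nf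
  simp

/-- The unitary `ξ ↦ e^{2πi g} ξ` on `L²(ℝ)`, for a measurable real function `g`. -/
def phaseOp (g : ℝ → ℝ) (hg : Measurable g) : L2R ≃ₗᵢ[ℂ] L2R where
  toLinearEquiv := LinearEquiv.ofLinearMap
    (mulOp _ (memLp_phase g hg)).toLinearMap
    (mulOp _ (memLp_phase (fun x => -g x) hg.neg)).toLinearMap
    (by
      ext1 ξ
      have := phase_inv_aux (fun x => -g x) hg.neg ξ
      simp only [neg_neg] at this
      exact this)
    (by
      ext1 ξ
      exact phase_inv_aux g hg ξ)
  norm_map' ξ := by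
    change ‖mulOp _ (memLp_phase g hg) ξ‖ = ‖ξ‖
    rw [Lp.norm_def, Lp.norm_def]
    congr 1
    refine eLpNorm_congr_norm_ae ?_
    filter_upwards [coeFn_mulOp _ (memLp_phase g hg) ξ] with x hx
    have := Complex.norm_exp_ofReal_mul_I (2 * Real.pi * g x)
    push_cast at this
    rw [hx, norm_mul, this, one_mul]

theorem coeFn_phaseOp (g : ℝ → ℝ) (hg : Measurable g) (ξ : L2R) :
    phaseOp g hg ξ =ᵐ[volume] fun x => exp (2 * Real.pi * g x * I) * ξ x :=
  coeFn_mulOp _ (memLp_phase g hg) ξ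

/-- The translation unitary `U_α` on `L²(ℝ)`: `(U_α ξ)(x) = ξ (x - α)`. -/
def translation (α : ℝ) : L2R ≃ₗᵢ[ℂ] L2R where
  toLinearEquiv := LinearEquiv.ofLinearMap
    (Lp.compMeasurePreservingₗ ℂ (fun x : ℝ => x - α) (measurePreserving_sub_right volume α))
    (Lp.compMeasurePreservingₗ ℂ (fun x : ℝ => x + α) (measurePreserving_add_right volume α))
    (by
      refine LinearMap.ext fun ξ => ?_
      change Lp.compMeasurePreserving _ _ (Lp.compMeasurePreserving _ _ ξ) = ξ
      rw [← Lp.compMeasurePreserving_comp_apply]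
      have h : (fun x : ℝ => x + α) ∘ (fun x : ℝ => x - α) = id := by
        funext x
        simp
      simp only [h]
      exact Lp.compMeasurePreserving_id_apply ξ)
    (by
      refine LinearMap.ext fun ξ => ?_
      change Lp.compMeasurePreserving _ _ (Lp.compMeasurePreserving _ _ ξ) = ξ
      rw [← Lp.compMeasurePreserving_comp_apply]
      have h : (fun x : ℝ => x - α) ∘ (fun x : ℝ => x + α) = id := by
        funext x
        simp
      simp only [h]
      exact Lp.compMeasurePreserving_id_apply ξ)
  norm_map' ξ := Lp.norm_compMeasurePreserving ξ (measurePreserving_sub_right volume α)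

theorem coeFn_translation (α : ℝ) (ξ : L2R) :
    translation α ξ =ᵐ[volume] fun x => ξ (x - α) :=
  Lp.coeFn_compMeasurePreserving ξ (measurePreserving_sub_right volume α)

/-! ### The rotation algebra -/

/-- `u v = e^{2πiħ} v u`, equivalently `v u v⁻¹ = e^{-2πiħ} u`: the relation between the generator
`u(t) = e^{2πit}` of `C(𝕋)` and the unitary `v` implementing translation by `ħ` on `𝕋 = ℝ/ℤ`. -/
def RotationRelation (ħ : ℝ) (u v : Op) : Prop :=
  u * v = exp (2 * Real.pi * ħ * I) • (v * u)

/-- The pairs of unitaries on `L²(ℝ)` that satisfy the rotation relation; these are the covariant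
representations of `(C(𝕋), ℤ, ħ)` on the separable infinite-dimensional Hilbert space `L²(ℝ)`. -/
abbrev CovariantPair (ħ : ℝ) : Type :=
  {p : unitary Op × unitary Op // RotationRelation ħ p.1 p.2}

/-- The C⋆-algebra of bounded families of operators indexed by the covariant pairs. -/
abbrev BigProduct (ħ : ℝ) : Type := lp (fun _ : CovariantPair ħ => Op) ∞

instance instIsTopologicalRingBigProduct (ħ : ℝ) : IsTopologicalRing (BigProduct ħ) :=
  @NonUnitalSeminormedRing.toIsTopologicalRing (BigProduct ħ) _

instance instContinuousStarBigProduct (ħ : ℝ) : ContinuousStar (BigProduct ħ) :=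
  ⟨(LipschitzWith.of_dist_le_mul (K := 1) fun a b => by
    rw [dist_eq_norm, dist_eq_norm, NNReal.coe_one, one_mul]
    exact ((congrArg norm (star_sub a b)).symm.trans (norm_star (a - b))).le).continuous⟩

/-- A family of unitaries, as a unitary of the product C⋆-algebra. -/
def familyUnitary (ħ : ℝ) (w : CovariantPair ħ → unitary Op) : unitary (BigProduct ħ) :=
  ⟨⟨fun i => (w i : Op), memℓp_infty ⟨1, by
      rintro _ ⟨i, rfl⟩
      exact (CStarRing.norm_coe_unitary (w i)).le⟩⟩, by
    rw [Unitary.mem_iff]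
    constructor
    · ext1
      funext i
      exact Unitary.coe_star_mul_self (w i)
    · ext1
      funext i
      exact Unitary.coe_mul_star_self (w i)⟩

/-- The generator `U` (the function `t ↦ e^{2πit}` on the circle). -/
def bigU (ħ : ℝ) : unitary (BigProduct ħ) := familyUnitary ħ fun i => i.1.1

/-- The generator `V` (implementing the translation by `ħ`). -/
def bigV (ħ : ℝ) : unitary (BigProduct ħ) := familyUnitary ħ fun i => i.1.2

/-- The rotation algebra `A_ħ = C(𝕋) ⋊_ħ ℤ`: the universal C⋆-algebra generated by two unitaries
`U`, `V` with `U V = e^{2πiħ} V U`, realised as the closed ⋆-subalgebra generated by the universal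
pair of unitaries. (It is separable, so representations on one separable infinite-dimensional
Hilbert space suffice.) -/
def rotationAlgebra (ħ : ℝ) : StarSubalgebra ℂ (BigProduct ħ) :=
  (StarAlgebra.adjoin ℂ {(bigU ħ : BigProduct ħ), (bigV ħ : BigProduct ħ)}).topologicalClosure

/-- The representation of `A_ħ` on `L²(ℝ)` given by a covariant pair `(u, v)`; it maps `U` to `u`
and `V` to `v`. -/
def repOfPair (ħ : ℝ) (i : CovariantPair ħ) : rotationAlgebra ħ →⋆ₐ[ℂ] Op where
  toFun a := (a : BigProduct ħ) i
  map_one' := rfl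
  map_mul' _ _ := rfl
  map_zero' := rfl
  map_add' _ _ := rfl
  commutes' _ := rfl
  map_star' _ := rfl

/-- The Schwartz subalgebra `A_ħ^∞`: the elements `∑ c_{nm} U^n V^m` of `A_ħ` with
`∑ |c_{nm}| (1 + n² + m²)^k < ∞` for all `k`. -/
def schwartzAlgebra (ħ : ℝ) : Set (rotationAlgebra ħ) :=
  {a | ∃ c : ℤ × ℤ → ℂ,
    (∀ k : ℕ, Summable fun p : ℤ × ℤ => ‖c p‖ * (1 + (p.1 : ℝ) ^ 2 + (p.2 : ℝ) ^ 2) ^ k) ∧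
    HasSum (fun p : ℤ × ℤ =>
      c p • (((bigU ħ ^ p.1 : unitary (BigProduct ħ)) : BigProduct ħ) *
        ((bigV ħ ^ p.2 : unitary (BigProduct ħ)) : BigProduct ħ))) (a : BigProduct ħ)}

/-- Multiplication by `e^{2πi g}` and translation by `α` form a covariant pair as soon as
`g (x - α) = g x - ħ`. -/
theorem rotationRelation_phase_translation (ħ α : ℝ) (g : ℝ → ℝ) (hg : Measurable g)
    (h : ∀ x, g (x - α) = g x - ħ) :
    RotationRelation ħ (Unitary.linearIsometryEquiv.symm (phaseOp g hg) : Op)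
      (Unitary.linearIsometryEquiv.symm (translation α) : Op) := by
  refine ContinuousLinearMap.ext fun ξ => ?_
  change phaseOp g hg (translation α ξ) =
    exp (2 * Real.pi * ħ * I) • translation α (phaseOp g hg ξ)
  refine Lp.ext ?_
  have h3 := (measurePreserving_sub_right (volume : Measure ℝ) α).quasiMeasurePreserving.ae
    (coeFn_phaseOp g hg ξ)
  filter_upwards [coeFn_phaseOp g hg (translation α ξ), coeFn_translation α ξ,
    coeFn_translation α (phaseOp g hg ξ), h3,
    Lp.coeFn_smul (exp (2 * Real.pi * ħ * I)) (translation α (phaseOp g hg ξ))] with x h1 h2 h4 h5 h6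
  rw [h6, Pi.smul_apply, h4, h5, h1, h2, h, smul_eq_mul, ← mul_assoc, ← exp_add]
  congr 2
  push_cast
  ring

/-- The covariant pair `(u, v_ħ)` on `L²(ℝ)`: `(u ξ)(x) = e^{2πix} ξ(x)` and
`(v_ħ ξ)(x) = ξ(x - ħ)`. -/
def heisenbergPair (ħ : ℝ) : CovariantPair ħ :=
  ⟨(Unitary.linearIsometryEquiv.symm (phaseOp (fun x => x) measurable_id),
    Unitary.linearIsometryEquiv.symm (translation ħ)),
    rotationRelation_phase_translation ħ ħ (fun x => x) measurable_id fun _ => rfl⟩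

/-- The representation `π_ħ : A_ħ → 𝔹(L²(ℝ))`. -/
def heisenbergRep (ħ : ℝ) : rotationAlgebra ħ →⋆ₐ[ℂ] Op := repOfPair ħ (heisenbergPair ħ)

theorem measurable_regularPhase (ħ : ℝ) :
    Measurable fun x : ℝ => Int.fract x + ħ * (⌊x⌋ : ℝ) := by
  fun_prop

/-- The regular representation of the crossed product on `L²(𝕋) ⊗ ℓ²(ℤ)`, the latter identified
with `L²(ℝ)` by `ℝ ∋ x ↔ (fract x, ⌊x⌋) ∈ [0, 1) × ℤ`: `f ∈ C(𝕋)` acts on the `n`-th copy of `L²(𝕋)`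
as multiplication by `t ↦ f(t + nħ)`, and `V` shifts the copies. -/
def regularPair (ħ : ℝ) : CovariantPair ħ :=
  ⟨(Unitary.linearIsometryEquiv.symm
      (phaseOp (fun x => Int.fract x + ħ * (⌊x⌋ : ℝ)) (measurable_regularPhase ħ)),
    Unitary.linearIsometryEquiv.symm (translation 1)),
    rotationRelation_phase_translation ħ 1 _ (measurable_regularPhase ħ) fun x => by
      rw [Int.fract_sub_one, Int.floor_sub_one]
      push_cast
      ring⟩

/-- The unit vector `1 ⊗ δ₀` of `L²(𝕋) ⊗ ℓ²(ℤ)`, that is, the indicator function of `[0, 1)`. -/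
def unitCell : L2R :=
  indicatorConstLp 2 (measurableSet_Ico (a := (0 : ℝ)) (b := 1)) (by simp) (1 : ℂ)

/-- The standard trace `τ` of `A_ħ`, `τ(∑ f_n V^n) = ∫_𝕋 f_0`: the vector state of `1 ⊗ δ₀` in the
regular representation. -/
def standardTrace (ħ : ℝ) (a : rotationAlgebra ħ) : ℂ :=
  inner ℂ unitCell (repOfPair ħ (regularPair ħ) a unitCell)

/-! ### The harmonic oscillator -/

/-- The operator `x` on Schwartz functions. -/
def position : 𝓢(ℝ, ℂ) →L[ℂ] 𝓢(ℝ, ℂ) := SchwartzMap.smulLeftCLM ℂ fun x : ℝ => (x : ℂ)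

/-- The operator `d/dx` on Schwartz functions. -/
def ddx : 𝓢(ℝ, ℂ) →L[ℂ] 𝓢(ℝ, ℂ) := SchwartzMap.derivCLM ℂ ℂ

/-- The harmonic oscillator `H = -d²/dx² + x²` on Schwartz functions. -/
def oscillator : 𝓢(ℝ, ℂ) →L[ℂ] 𝓢(ℝ, ℂ) := -(ddx * ddx) + position * position

/-- The creation operator `A* = x - d/dx` on Schwartz functions. -/
def creation : 𝓢(ℝ, ℂ) →L[ℂ] 𝓢(ℝ, ℂ) := position - ddx

theorem abs_pow_mul_gaussian_le (m : ℕ) (x : ℝ) :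
    |x| ^ m * Real.exp (-(x ^ 2 / 2)) ≤ m.factorial * Real.exp (1 / 2) := by
  have h1 : |x| ^ m ≤ m.factorial * Real.exp |x| := by
    have := Real.pow_div_factorial_le_exp |x| (abs_nonneg x) m
    rwa [div_le_iff₀ (by positivity), mul_comm] at this
  calc |x| ^ m * Real.exp (-(x ^ 2 / 2))
      ≤ m.factorial * Real.exp |x| * Real.exp (-(x ^ 2 / 2)) := by gcongr
    _ = m.factorial * Real.exp (|x| - x ^ 2 / 2) := by
        rw [mul_assoc, ← Real.exp_add, sub_eq_add_neg]
    _ ≤ m.factorial * Real.exp (1 / 2) := by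
        gcongr
        nlinarith [sq_nonneg (|x| - 1), sq_abs x]

theorem gaussian_decay (k n : ℕ) : ∃ C, ∀ x : ℝ,
    ‖x‖ ^ k * ‖iteratedFDeriv ℝ n (fun y : ℝ => Real.exp (-(y ^ 2 / 2))) x‖ ≤ C := by
  refine ⟨∑ i ∈ Finset.range ((Polynomial.hermite n).natDegree + 1),
    ‖((Polynomial.hermite n).coeff i : ℝ)‖ * ((k + i).factorial * Real.exp (1 / 2)), fun x => ?_⟩
  rw [norm_iteratedFDeriv_eq_norm_iteratedDeriv, iteratedDeriv_eq_iterate,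
    Polynomial.deriv_gaussian_eq_hermite_mul_gaussian, norm_mul, norm_mul, norm_pow, norm_neg,
    norm_one, one_pow, one_mul, Polynomial.aeval_eq_sum_range]
  calc ‖x‖ ^ k * (‖∑ i ∈ Finset.range ((Polynomial.hermite n).natDegree + 1),
        (Polynomial.hermite n).coeff i • x ^ i‖ * ‖Real.exp (-(x ^ 2 / 2))‖)
      ≤ ‖x‖ ^ k * ((∑ i ∈ Finset.range ((Polynomial.hermite n).natDegree + 1),
        ‖(Polynomial.hermite n).coeff i • x ^ i‖) * ‖Real.exp (-(x ^ 2 / 2))‖) := by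
        gcongr
        exact norm_sum_le _ _
    _ = ∑ i ∈ Finset.range ((Polynomial.hermite n).natDegree + 1),
        ‖((Polynomial.hermite n).coeff i : ℝ)‖ * (|x| ^ (k + i) * Real.exp (-(x ^ 2 / 2))) := by
        rw [Finset.sum_mul, Finset.mul_sum]
        refine Finset.sum_congr rfl fun i _ => ?_
        rw [zsmul_eq_mul, norm_mul, norm_pow, Real.norm_eq_abs x, Real.norm_eq_abs (Real.exp _),
          Real.abs_exp, pow_add]
        ring
    _ ≤ _ := by
        refine Finset.sum_le_sum fun i _ => ?_
        exact mul_le_mul_of_nonneg_left (abs_pow_mul_gaussian_le (k + i) x) (norm_nonneg _)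

/-- The Gaussian `e^{-x²/2}` as a Schwartz function. -/
def gaussian : 𝓢(ℝ, ℝ) where
  toFun x := Real.exp (-(x ^ 2 / 2))
  smooth' := by fun_prop
  decay' := gaussian_decay

/-- The eigenfunctions of `H`: `ψ₀ = π^{-1/4} e^{-x²/2}` and `ψ_{k+1} = (2(k+1))^{-1/2} A* ψ_k`. -/
def eigenfunction : ℕ → 𝓢(ℝ, ℂ)
  | 0 => ((Real.pi ^ (-(1 / 4) : ℝ) : ℝ) : ℂ) •
      SchwartzMap.postcompCLM (𝕜 := ℝ) Complex.ofRealCLM gaussian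
  | k + 1 => (((2 * ((k : ℝ) + 1)) ^ (-(1 / 2) : ℝ) : ℝ) : ℂ) • creation (eigenfunction k)

theorem position_apply (f : 𝓢(ℝ, ℂ)) (x : ℝ) : position f x = x * f x := by
  rw [position, SchwartzMap.smulLeftCLM_apply_apply (by fun_prop), smul_eq_mul]

theorem ddx_apply (f : 𝓢(ℝ, ℂ)) (x : ℝ) : ddx f x = deriv f x := rfl

theorem ddx_position (f : 𝓢(ℝ, ℂ)) : ddx (position f) = f + position (ddx f) := by
  ext x
  have h : (position f : ℝ → ℂ) = fun x : ℝ => (x : ℂ) * f x := funext (position_apply f)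
  rw [ddx_apply, h, add_apply, position_apply, ddx_apply]
  have := (Complex.ofRealCLM.hasDerivAt (x := x)).mul (f.hasDerivAt x)
  refine (this.deriv.trans ?_ :)
  simp

theorem ddx_eigenfunction_zero : ddx (eigenfunction 0) = -position (eigenfunction 0) := by
  ext x
  have h : (eigenfunction 0 : ℝ → ℂ) = fun x : ℝ =>
      ((Real.pi ^ (-(1 / 4) : ℝ) : ℝ) : ℂ) * ((Real.exp (-(x ^ 2 / 2)) : ℝ) : ℂ) := rfl
  rw [ddx_apply, neg_apply, position_apply, h]
  have h1 : HasDerivAt (fun x : ℝ => Real.exp (-(x ^ 2 / 2))) (Real.exp (-(x ^ 2 / 2)) * -x) x := by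
    have := (((hasDerivAt_id x).pow 2).div_const 2).neg.exp
    refine this.congr_deriv ?_
    simp
  have := (h1.ofReal_comp.const_mul ((Real.pi ^ (-(1 / 4) : ℝ) : ℝ) : ℂ)).deriv
  rw [this]
  push_cast
  ring

/-- `ψ_k` is an eigenvector of the harmonic oscillator with eigenvalue `2k + 1`. -/
theorem oscillator_eigenfunction (k : ℕ) :
    oscillator (eigenfunction k) = (2 * (k : ℂ) + 1) • eigenfunction k := by
  induction k with
  | zero =>
    change -ddx (ddx (eigenfunction 0)) + position (position (eigenfunction 0)) = _
    rw [ddx_eigenfunction_zero, map_neg, ddx_position, ddx_eigenfunction_zero, map_neg]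
    simp
  | succ k ih =>
    have hcomm : ∀ f, oscillator (creation f) = creation (oscillator f) + (2 : ℂ) • creation f := by
      intro f
      change -ddx (ddx (position f - ddx f)) + position (position (position f - ddx f)) =
        (position (-ddx (ddx f) + position (position f)) -
          ddx (-ddx (ddx f) + position (position f))) + (2 : ℂ) • (position f - ddx f)
      simp only [map_sub, map_add, map_neg, ddx_position, two_smul]
      abel
    rw [eigenfunction, map_smul, hcomm, ih, map_smul, smul_comm]
    rw [← add_smul]
    congr 2
    push_cast
    ring

/-- The vector of `L²(ℝ)` given by `ψ_k`; these vectors form an orthonormal basis of `L²(ℝ)`. -/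
def eigenvector (k : ℕ) : L2R := (eigenfunction k).toLp 2 volume

/-- The complex power `H^{-s}`, for `Re s > 1`, of the (self-adjoint extension of the) harmonic
oscillator: the operator that is diagonal in the basis `ψ_k` with eigenvalues `(2k + 1)^{-s}`, as
the norm-convergent sum `∑ (2k + 1)^{-s} ⟨ψ_k, ·⟩ ψ_k`. -/
def oscillatorPow (s : ℂ) : Op :=
  ∑' k : ℕ, (2 * (k : ℂ) + 1) ^ (-s) • InnerProductSpace.rankOne ℂ (eigenvector k) (eigenvector k)

/-! ### Traces -/

/-- `T` is trace class (nuclear): `T = ∑ ⟨y_n, ·⟩ x_n` with `∑ ‖x_n‖ ‖y_n‖ < ∞`. -/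
def IsTraceClass (T : Op) : Prop :=
  ∃ x y : ℕ → L2R, Summable (fun n => ‖x n‖ * ‖y n‖) ∧
    HasSum (fun n => InnerProductSpace.rankOne ℂ (x n) (y n)) T

/-- `T` is trace class and its trace is `c`: `∑ ⟨e_i, T e_i⟩ = c` for every Hilbert basis. -/
def HasTrace (T : Op) (c : ℂ) : Prop :=
  IsTraceClass T ∧
    ∀ (ι : Type) (e : HilbertBasis ι ℂ L2R), HasSum (fun i => inner ℂ (e i) (T (e i))) c

end Heisenberg

end

/-! Since `H` is diagonal, `Tr (T H^{-s}) = ∑ (2k+1)^{-s} ⟨ψ_k, T ψ_k⟩`, and the continuation is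
governed by the Abel sums `A(t) = ∑ t^k ⟨ψ_k, T ψ_k⟩` as `t → 1`: with `t = e^{-2y}`, `e^{-y} A(t)`
is the heat trace `Tr (T e^{-yH})`, whose Mellin transform is `Γ(s) Tr (T H^{-s})`. If the heat
trace is bounded by a multiple of `e^{-y}` and vanishes to infinite order at `y = 0`, its Mellin
transform is entire, and so is its product with `1/Γ` (`exists_entire_of_abel_bound`).

Mehler's formula makes `A(t)` explicit. For `T = g · (translation by q)` it is the integral of
`g(x)` against the Mehler kernel at `(x, x - q)`. For `g = e^{ipx}` its modulus is `(1-t)⁻¹ exp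
(-(p²+q²)/4 · (1+t)/(1-t))` (`integral_exp_mul_mehlerKernel`), so only `p = q = 0` escapes the rapid
decay. For bounded `g`, positivity of the kernel reduces to `p = 0`, which gives (b) as `q = α ≠ 0`.

For (a), `U^n V^m` has `p = 2πn`, `q = mħ`. The monomials with `p = q = 0` act as the identity and
contribute their total coefficient times `∑ (2k+1)^{-s} = (1 - 2^{-s}) ζ(s)`, with residue `1/2` at
`s = 1`. For the others `p² + q²` is bounded below, `n` and `m` being integers, so the absolutely
summable rest is entire (`exists_trace_continuation`). When `ħ ≠ 0` the only identity monomial is `n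
= m = 0`, whose coefficient is `τ(a)`. -/

noncomputable section

namespace Heisenberg

/-! ### Hermite polynomials and Mehler's formula -/

/-- The monic Hermite polynomials for the weight `e^{-x²}`, as functions on `ℝ`. -/
def monicHermite : ℕ → ℝ → ℝ
  | 0, _ => 1
  | 1, x => x
  | k + 2, x => x * monicHermite (k + 1) x - ((k : ℝ) + 1) / 2 * monicHermite k x

theorem monicHermite_succ_succ (k : ℕ) (x : ℝ) : monicHermite (k + 2) x =
    x * monicHermite (k + 1) x - ((k : ℝ) + 1) / 2 * monicHermite k x := by
  rw [monicHermite]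

/-- Differentiating the three-term recurrence reproduces it one degree lower, hence the two-step
induction. -/
theorem hasDerivAt_monicHermite (k : ℕ) (x : ℝ) :
    HasDerivAt (monicHermite (k + 1)) (((k : ℝ) + 1) * monicHermite k x) x := by
  induction k using Nat.twoStepInduction with
  | zero =>
    have h : monicHermite 1 = fun x => x := by funext y; rw [monicHermite]
    rw [zero_add, h]
    simpa [monicHermite] using hasDerivAt_id' x
  | one =>
    have h : monicHermite 2 = fun x => x * x - (0 + 1) / 2 * 1 := by
      funext y; simp [monicHermite]
    rw [one_add_one_eq_two, h]
    refine (((hasDerivAt_id x).mul (hasDerivAt_id x)).sub_const _).congr_deriv ?_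
    simp [monicHermite]
    ring
  | more k ih1 ih2 =>
    have h : monicHermite (k + 2 + 1) = fun x =>
        x * monicHermite (k + 2) x - (((k + 1 : ℕ) : ℝ) + 1) / 2 * monicHermite (k + 1) x :=
      funext fun y => monicHermite_succ_succ (k + 1) y
    rw [h]
    refine (((hasDerivAt_id x).mul ih2).sub (ih1.const_mul _)).congr_deriv ?_
    simp only [id, monicHermite_succ_succ]
    push_cast
    ring

/-- The constant by which `ψ_k` differs from `q_k(x) e^{-x²/2}`. -/
def hermiteNorm (k : ℕ) : ℝ :=
  Real.pi ^ (-(1 / 4) : ℝ) * ((2 : ℝ) ^ k / k.factorial) ^ (1 / 2 : ℝ)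

theorem hermiteNorm_succ (k : ℕ) :
    (2 * ((k : ℝ) + 1)) ^ (-(1 / 2) : ℝ) * hermiteNorm k * 2 = hermiteNorm (k + 1) := by
  have h1 : (2 : ℝ) ^ (k + 1) / ((k + 1).factorial : ℝ) =
      (2 ^ k / k.factorial) * ((2 * ((k : ℝ) + 1))⁻¹ * (2 * 2)) := by
    rw [Nat.factorial_succ]
    push_cast
    field_simp
    ring
  have h2 : ((2 * 2 : ℝ)) ^ (1 / 2 : ℝ) = 2 := by
    rw [← Real.sqrt_eq_rpow, Real.sqrt_mul_self (by norm_num)]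
  rw [hermiteNorm, hermiteNorm, h1, Real.rpow_neg (by positivity),
    ← Real.inv_rpow (by positivity), Real.mul_rpow (y := _ * (2 * 2)) (by positivity) (by positivity),
    Real.mul_rpow (y := 2 * 2) (by positivity) (by positivity), h2]
  ring

theorem hermiteNorm_sq (k : ℕ) :
    hermiteNorm k * hermiteNorm k = (Real.sqrt Real.pi)⁻¹ * (2 ^ k / k.factorial) := by
  have h1 : Real.pi ^ (-(1 / 4) : ℝ) * Real.pi ^ (-(1 / 4) : ℝ) = (Real.sqrt Real.pi)⁻¹ := by
    rw [← Real.rpow_add Real.pi_pos, Real.sqrt_eq_rpow, ← Real.rpow_neg Real.pi_pos.le]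
    norm_num
  have h2 : ((2 : ℝ) ^ k / k.factorial) ^ (1 / 2 : ℝ) * ((2 : ℝ) ^ k / k.factorial) ^ (1 / 2 : ℝ) =
      2 ^ k / k.factorial := by
    rw [← Real.sqrt_eq_rpow, Real.mul_self_sqrt (by positivity)]
  rw [hermiteNorm, mul_mul_mul_comm, h1, h2]

theorem hasDerivAt_gaussian (x : ℝ) :
    HasDerivAt (fun x : ℝ => Real.exp (-(x ^ 2 / 2))) (-(x * Real.exp (-(x ^ 2 / 2)))) x := by
  have := (((hasDerivAt_id x).pow 2).div_const 2).neg.exp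
  refine this.congr_deriv ?_
  simp
  ring

/-- On `q e^{-x²/2}` the operator `x - d/dx` acts as `q ↦ 2xq - q'`. For `q = q_k` this is `2
q_{k+1}` by the derivative rule and the recurrence; the factor 2 is the one in `hermiteNorm_succ`.
-/
theorem eigenfunction_apply (k : ℕ) (x : ℝ) : eigenfunction k x =
    ((hermiteNorm k * (monicHermite k x * Real.exp (-(x ^ 2 / 2))) : ℝ) : ℂ) := by
  induction k generalizing x with
  | zero =>
    have h : eigenfunction 0 x =
      ((Real.pi ^ (-(1 / 4) : ℝ) : ℝ) : ℂ) * ((Real.exp (-(x ^ 2 / 2)) : ℝ) : ℂ) := rfl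
    rw [h]
    simp [hermiteNorm, monicHermite]
  | succ k ih =>
    have h : eigenfunction (k + 1) x = (((2 * ((k : ℝ) + 1)) ^ (-(1 / 2) : ℝ) : ℝ) : ℂ) *
        (position (eigenfunction k) x - ddx (eigenfunction k) x) := by
      rw [eigenfunction]; rfl
    have hd : ∀ q' : ℝ, HasDerivAt (monicHermite k) q' x → ddx (eigenfunction k) x =
        ((hermiteNorm k * (q' * Real.exp (-(x ^ 2 / 2)) +
          monicHermite k x * -(x * Real.exp (-(x ^ 2 / 2)))) : ℝ) : ℂ) := by
      intro q' hq
      rw [ddx_apply, show (eigenfunction k : ℝ → ℂ) = _ from funext ih]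
      exact ((hq.mul (hasDerivAt_gaussian x)).const_mul _).ofReal_comp.deriv
    rw [h, position_apply, ih, ← hermiteNorm_succ]
    cases k with
    | zero =>
      have h1 : monicHermite 0 = fun _ => 1 := by funext y; rw [monicHermite]
      rw [hd 0 (by rw [h1]; exact hasDerivAt_const x 1)]
      simp only [monicHermite]
      push_cast
      ring
    | succ k =>
      rw [hd _ (hasDerivAt_monicHermite k x), monicHermite_succ_succ]
      push_cast
      ring

theorem norm_ofReal_add_ofReal_mul_I_sq (x u : ℝ) : ‖(x : ℂ) + u * I‖ ^ 2 = x ^ 2 + u ^ 2 := by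
  rw [← Complex.normSq_eq_norm_sq, Complex.normSq_add_mul_I]

theorem norm_ofReal_exp_neg_sq (u : ℝ) : ‖((Real.exp (-u ^ 2) : ℝ) : ℂ)‖ = Real.exp (-u ^ 2) := by
  rw [Complex.norm_real, Real.norm_eq_abs, Real.abs_exp]

theorem integrable_pow_mul_gaussian (k : ℕ) (x : ℝ) :
    Integrable fun u : ℝ => ((x : ℂ) + u * I) ^ k * ((Real.exp (-u ^ 2) : ℝ) : ℂ) := by
  -- With `ρ = |x + iu|`: `ρ^k ≤ k! e^ρ` and `ρ ≤ 1 + ρ²/4`, where `ρ² = x² + u²`; this uses up a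
  -- quarter of the Gaussian decay.
  refine Integrable.mono' ((integrable_exp_neg_mul_sq (b := 3 / 4) (by norm_num)).const_mul
    (k.factorial * Real.exp (1 + x ^ 2 / 4))) (by fun_prop) (Eventually.of_forall fun u => ?_)
  have h1 := Real.pow_div_factorial_le_exp ‖(x : ℂ) + u * I‖ (norm_nonneg _) k
  rw [div_le_iff₀ (by positivity), mul_comm (Real.exp _)] at h1
  rw [norm_mul, norm_pow, norm_ofReal_exp_neg_sq]
  calc ‖(x : ℂ) + u * I‖ ^ k * Real.exp (-u ^ 2)
      ≤ k.factorial * Real.exp ‖(x : ℂ) + u * I‖ * Real.exp (-u ^ 2) := by gcongr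
    _ ≤ k.factorial * Real.exp (1 + (x ^ 2 + u ^ 2) / 4) * Real.exp (-u ^ 2) := by
        gcongr
        rw [← norm_ofReal_add_ofReal_mul_I_sq]
        nlinarith [sq_nonneg (‖(x : ℂ) + u * I‖ / 2 - 1)]
    _ = _ := by
        rw [mul_assoc, mul_assoc, ← Real.exp_add, ← Real.exp_add]
        ring_nf

/-- Hermite polynomials are Gaussian averages of `(x + iu)^k`: integration by parts gives these
averages the Hermite recurrence. In this form they can be summed by the exponential series. -/
theorem integral_pow_mul_gaussian (k : ℕ) (x : ℝ) :
    ∫ u : ℝ, ((x : ℂ) + u * I) ^ k * ((Real.exp (-u ^ 2) : ℝ) : ℂ) =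
      ((Real.sqrt Real.pi * monicHermite k x : ℝ) : ℂ) := by
  have hrec : ∀ k : ℕ, ∫ u : ℝ, ((x : ℂ) + u * I) ^ (k + 1) * ((Real.exp (-u ^ 2) : ℝ) : ℂ) =
      x * (∫ u : ℝ, ((x : ℂ) + u * I) ^ k * ((Real.exp (-u ^ 2) : ℝ) : ℂ)) -
      (k : ℂ) / 2 * ∫ u : ℝ, ((x : ℂ) + u * I) ^ (k - 1) * ((Real.exp (-u ^ 2) : ℝ) : ℂ) := by
    intro k
    have hi1 := (integrable_pow_mul_gaussian k x).const_mul (x : ℂ)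
    have hi2 := (integrable_pow_mul_gaussian (k - 1) x).const_mul ((k : ℂ) / 2)
    have hi3 := integrable_pow_mul_gaussian (k + 1) x
    -- The primitive is chosen so that `-iu = x - (x + iu)` raises the power by one. At `k = 0` the
    -- truncated exponent `k - 1` is harmless, its coefficient being `k`.
    have hder : ∀ u : ℝ, HasDerivAt
        (fun u : ℝ => I / 2 * (((x : ℂ) + u * I) ^ k * ((Real.exp (-u ^ 2) : ℝ) : ℂ)))
        (x * (((x : ℂ) + u * I) ^ k * ((Real.exp (-u ^ 2) : ℝ) : ℂ)) -
          (k : ℂ) / 2 * (((x : ℂ) + u * I) ^ (k - 1) * ((Real.exp (-u ^ 2) : ℝ) : ℂ)) -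
          ((x : ℂ) + u * I) ^ (k + 1) * ((Real.exp (-u ^ 2) : ℝ) : ℂ)) u := by
      intro u
      have h1 : HasDerivAt (fun u : ℝ => (x : ℂ) + u * I) I u := by
        simpa using ((Complex.ofRealCLM.hasDerivAt (x := u)).mul_const I).const_add (x : ℂ)
      have h2 : HasDerivAt (fun u : ℝ => Real.exp (-u ^ 2)) (Real.exp (-u ^ 2) * -(2 * u)) u := by
        have := ((hasDerivAt_id u).pow 2).neg.exp
        refine this.congr_deriv ?_
        simp
      refine (((h1.pow k).mul h2.ofReal_comp).const_mul (I / 2)).congr_deriv ?_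
      simp only [Pi.pow_apply]
      push_cast
      linear_combination ((x : ℂ) + u * I) ^ (k - 1) * k / 2 * cexp (-u ^ 2) * I_sq
    have h0 := integral_eq_zero_of_hasDerivAt_of_integrable hder ((hi1.sub hi2).sub hi3)
      ((integrable_pow_mul_gaussian k x).const_mul _)
    have h1 := integral_sub (hi1.sub hi2) hi3
    simp only [Pi.sub_apply] at h1
    rw [h1, integral_sub hi1 hi2, integral_const_mul, integral_const_mul] at h0
    exact (sub_eq_zero.mp h0).symm
  have hzero : ∫ u : ℝ, ((x : ℂ) + u * I) ^ 0 * ((Real.exp (-u ^ 2) : ℝ) : ℂ) =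
      ((Real.sqrt Real.pi : ℝ) : ℂ) := by
    have := integral_gaussian 1
    simp only [pow_zero, one_mul, integral_complex_ofReal]
    simp only [neg_mul, one_mul, div_one] at this
    rw [this]
  induction k using Nat.twoStepInduction with
  | zero => rw [hzero, monicHermite]; simp
  | one =>
    have := hrec 0
    rw [hzero] at this
    rw [zero_add] at this
    rw [this, monicHermite]
    push_cast
    ring
  | more k ih1 ih2 =>
    rw [hrec (k + 1), ih2, Nat.add_sub_cancel, ih1, monicHermite_succ_succ]
    push_cast
    ring

/-- From `2ρσ ≤ ρ² + σ²`, the exponent is at most `t(x² + y²) - (1-t)(u² + v²)`. -/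
theorem integrable_exp_mul_gaussian_prod {t : ℝ} (ht0 : 0 ≤ t) (ht1 : t < 1) (x y : ℝ) :
    Integrable (fun p : ℝ × ℝ => Real.exp (2 * t * (‖(x : ℂ) + p.1 * I‖ * ‖(y : ℂ) + p.2 * I‖)) *
      (Real.exp (-p.1 ^ 2) * Real.exp (-p.2 ^ 2))) (volume.prod volume) := by
  have h := integrable_exp_neg_mul_sq (b := 1 - t) (by linarith)
  refine Integrable.mono' ((h.mul_prod h).const_mul (Real.exp (t * (x ^ 2 + y ^ 2))))
    (by fun_prop) (Eventually.of_forall fun p => ?_)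
  rw [Real.norm_of_nonneg (by positivity), ← Real.exp_add, ← Real.exp_add, ← Real.exp_add,
    ← Real.exp_add, Real.exp_le_exp]
  have h1 := norm_ofReal_add_ofReal_mul_I_sq x p.1
  have h2 := norm_ofReal_add_ofReal_mul_I_sq y p.2
  nlinarith [mul_nonneg ht0 (sq_nonneg (‖(x : ℂ) + p.1 * I‖ - ‖(y : ℂ) + p.2 * I‖))]

/-- The double Gaussian integral behind Mehler's formula. -/
theorem integral_exp_mul_gaussian_prod {t : ℝ} (ht0 : 0 ≤ t) (ht1 : t < 1) (x y : ℝ) :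
    ∫ p : ℝ × ℝ, cexp (2 * t * (((x : ℂ) + p.1 * I) * ((y : ℂ) + p.2 * I))) *
      (((Real.exp (-p.1 ^ 2) : ℝ) : ℂ) * ((Real.exp (-p.2 ^ 2) : ℝ) : ℂ)) ∂(volume.prod volume) =
    ((Real.pi * (Real.sqrt (1 - t ^ 2))⁻¹ *
      Real.exp ((2 * t * x * y - t ^ 2 * (x ^ 2 + y ^ 2)) / (1 - t ^ 2)) : ℝ) : ℂ) := by
  have ht2 : 0 < 1 - t ^ 2 := by nlinarith
  have ht2' : (1 - (t : ℂ) ^ 2) ≠ 0 := by exact_mod_cast ht2.ne'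
  have hinteg : Integrable (fun p : ℝ × ℝ =>
      cexp (2 * t * (((x : ℂ) + p.1 * I) * ((y : ℂ) + p.2 * I))) *
      (((Real.exp (-p.1 ^ 2) : ℝ) : ℂ) * ((Real.exp (-p.2 ^ 2) : ℝ) : ℂ)))
      (volume.prod volume) := by
    refine Integrable.mono' (integrable_exp_mul_gaussian_prod ht0 ht1 x y) (by fun_prop)
      (Eventually.of_forall fun p => ?_)
    rw [norm_mul, norm_mul, norm_ofReal_exp_neg_sq, norm_ofReal_exp_neg_sq]
    gcongr
    refine (Complex.norm_exp_le_exp_norm _).trans_eq ?_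
    simp [abs_of_nonneg ht0]
  have hsqrt : ∀ a : ℝ, 0 ≤ a → (a : ℂ) ^ (1 / 2 : ℂ) = ((Real.sqrt a : ℝ) : ℂ) := by
    intro a ha
    rw [Real.sqrt_eq_rpow, Complex.ofReal_cpow ha]
    norm_num
  rw [integral_prod _ hinteg]
  -- Completing the square in `v` leaves a quadratic in `u` with leading coefficient `-(1 - t²)`,
  -- the source of the factor `(1 - t²)^{-1/2}`.
  have hinner : ∀ u : ℝ, ∫ v : ℝ, cexp (2 * t * (((x : ℂ) + u * I) * ((y : ℂ) + v * I))) *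
      (((Real.exp (-u ^ 2) : ℝ) : ℂ) * ((Real.exp (-v ^ 2) : ℝ) : ℂ)) =
      ((Real.sqrt Real.pi : ℝ) : ℂ) * cexp (-((1 - t ^ 2 : ℝ) : ℂ) * u ^ 2 +
        2 * t * (y - t * x) * I * u + (2 * t * x * y - t ^ 2 * x ^ 2)) := by
    intro u
    have h1 := integral_cexp_quadratic (b := -1) (by simp) (2 * t * ((x : ℂ) + u * I) * I)
      (2 * t * ((x : ℂ) + u * I) * y - u ^ 2)
    rw [neg_neg, div_one, hsqrt _ Real.pi_pos.le] at h1
    calc _ = ∫ v : ℝ, cexp (-1 * (v : ℂ) ^ 2 + 2 * t * ((x : ℂ) + u * I) * I * v +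
          (2 * t * ((x : ℂ) + u * I) * y - u ^ 2)) := by
          congr 1
          funext v
          push_cast
          rw [← Complex.exp_add, ← Complex.exp_add]
          ring_nf
      _ = _ := by
          rw [h1]
          congr 2
          push_cast
          linear_combination (2 * t ^ 2 * x * u * I + t ^ 2 * x ^ 2 + t ^ 2 * u ^ 2 * (I ^ 2 - 1)) * I_sq
  simp only [hinner]
  rw [integral_const_mul, integral_cexp_quadratic (by rw [← ofReal_neg, ofReal_re]; linarith), neg_neg,
    ← Complex.ofReal_div, hsqrt _ (by positivity), Real.sqrt_div Real.pi_pos.le, ← mul_assoc]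
  have hpi : Real.pi = Real.sqrt Real.pi * Real.sqrt Real.pi :=
    (Real.mul_self_sqrt Real.pi_pos.le).symm
  have hex : (2 * t * x * y - t ^ 2 * x ^ 2 : ℂ) -
      (2 * t * (y - t * x) * I) ^ 2 / (4 * -((1 - t ^ 2 : ℝ) : ℂ)) =
      (((2 * t * x * y - t ^ 2 * (x ^ 2 + y ^ 2)) / (1 - t ^ 2) : ℝ) : ℂ) := by
    push_cast
    field_simp
    linear_combination (4 * t ^ 2 * (y - t * x) ^ 2 : ℂ) * I_sq
  rw [hex]
  conv_rhs => rw [hpi]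
  push_cast
  ring

theorem hasSum_pow_div_factorial_real (a : ℝ) :
    HasSum (fun k : ℕ => a ^ k / k.factorial) (Real.exp a) := by
  rw [Real.exp_eq_exp_ℝ]
  exact NormedSpace.expSeries_div_hasSum_exp a

theorem hasSum_pow_div_factorial_complex (a : ℂ) :
    HasSum (fun k : ℕ => a ^ k / k.factorial) (cexp a) := by
  rw [Complex.exp_eq_exp_ℂ]
  exact NormedSpace.expSeries_div_hasSum_exp a

/-- Both factors are written as Gaussian averages, so the series becomes an exponential series under
a double integral. The series of absolute values has an integrable sum, which justifies the
interchange. -/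
theorem hasSum_monicHermite_mul {t : ℝ} (ht0 : 0 ≤ t) (ht1 : t < 1) (x y : ℝ) :
    HasSum (fun k : ℕ => (2 * t) ^ k / k.factorial * (monicHermite k x * monicHermite k y))
      ((Real.sqrt (1 - t ^ 2))⁻¹ *
        Real.exp ((2 * t * x * y - t ^ 2 * (x ^ 2 + y ^ 2)) / (1 - t ^ 2))) := by
  have hsum : ∀ p : ℝ × ℝ, HasSum
      (fun k : ℕ => (2 * t * (‖(x : ℂ) + p.1 * I‖ * ‖(y : ℂ) + p.2 * I‖)) ^ k / k.factorial *
        (Real.exp (-p.1 ^ 2) * Real.exp (-p.2 ^ 2)))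
      (Real.exp (2 * t * (‖(x : ℂ) + p.1 * I‖ * ‖(y : ℂ) + p.2 * I‖)) *
        (Real.exp (-p.1 ^ 2) * Real.exp (-p.2 ^ 2))) := by
    intro p
    exact (hasSum_pow_div_factorial_real _).mul_right _
  have h := hasSum_integral_of_dominated_convergence (μ := (volume : Measure ℝ).prod volume)
    (F := fun (k : ℕ) (p : ℝ × ℝ) =>
      (2 * t * (((x : ℂ) + p.1 * I) * ((y : ℂ) + p.2 * I))) ^ k / k.factorial *
        (((Real.exp (-p.1 ^ 2) : ℝ) : ℂ) * ((Real.exp (-p.2 ^ 2) : ℝ) : ℂ)))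
    (f := fun p => cexp (2 * t * (((x : ℂ) + p.1 * I) * ((y : ℂ) + p.2 * I))) *
      (((Real.exp (-p.1 ^ 2) : ℝ) : ℂ) * ((Real.exp (-p.2 ^ 2) : ℝ) : ℂ)))
    (fun k p => (2 * t * (‖(x : ℂ) + p.1 * I‖ * ‖(y : ℂ) + p.2 * I‖)) ^ k / k.factorial *
        (Real.exp (-p.1 ^ 2) * Real.exp (-p.2 ^ 2)))
    (fun k => by fun_prop)
    (fun k => Eventually.of_forall fun p => by
      rw [norm_mul, norm_mul, norm_ofReal_exp_neg_sq, norm_ofReal_exp_neg_sq]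
      simp [abs_of_nonneg ht0])
    (Eventually.of_forall fun p => (hsum p).summable)
    ((integrable_exp_mul_gaussian_prod ht0 ht1 x y).congr
      (Eventually.of_forall fun p => (hsum p).tsum_eq.symm))
    (Eventually.of_forall fun p => (hasSum_pow_div_factorial_complex _).mul_right _)
  rw [integral_exp_mul_gaussian_prod ht0 ht1] at h
  have hk : ∀ k : ℕ, ∫ p : ℝ × ℝ,
      (2 * t * (((x : ℂ) + p.1 * I) * ((y : ℂ) + p.2 * I))) ^ k / k.factorial *
        (((Real.exp (-p.1 ^ 2) : ℝ) : ℂ) * ((Real.exp (-p.2 ^ 2) : ℝ) : ℂ))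
        ∂((volume : Measure ℝ).prod volume) =
      ((Real.pi * ((2 * t) ^ k / k.factorial * (monicHermite k x * monicHermite k y)) : ℝ) : ℂ) := by
    intro k
    have h1 : ∀ p : ℝ × ℝ, (2 * t * (((x : ℂ) + p.1 * I) * ((y : ℂ) + p.2 * I))) ^ k / k.factorial *
        (((Real.exp (-p.1 ^ 2) : ℝ) : ℂ) * ((Real.exp (-p.2 ^ 2) : ℝ) : ℂ)) =
        (2 * t) ^ k / k.factorial * ((((x : ℂ) + p.1 * I) ^ k * ((Real.exp (-p.1 ^ 2) : ℝ) : ℂ)) *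
          (((y : ℂ) + p.2 * I) ^ k * ((Real.exp (-p.2 ^ 2) : ℝ) : ℂ))) := by
      intro p
      rw [mul_pow, mul_pow (_ + _)]
      ring
    simp only [h1]
    rw [integral_const_mul, integral_prod_mul
      (fun u : ℝ => ((x : ℂ) + u * I) ^ k * ((Real.exp (-u ^ 2) : ℝ) : ℂ))
      (fun u : ℝ => ((y : ℂ) + u * I) ^ k * ((Real.exp (-u ^ 2) : ℝ) : ℂ)),
      integral_pow_mul_gaussian, integral_pow_mul_gaussian]
    have hpi : (Real.pi : ℂ) = (Real.sqrt Real.pi : ℝ) * (Real.sqrt Real.pi : ℝ) := by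
      exact_mod_cast (Real.mul_self_sqrt Real.pi_pos.le).symm
    push_cast
    rw [hpi]
    ring
  simp only [hk] at h
  have h' := (Complex.hasSum_ofReal.mp h).mul_left Real.pi⁻¹
  simpa only [mul_assoc Real.pi, inv_mul_cancel_left₀ Real.pi_ne_zero] using h'

/-- The Mehler kernel. -/
def mehlerKernel (t x y : ℝ) : ℝ :=
  (Real.sqrt Real.pi)⁻¹ * (Real.sqrt (1 - t ^ 2))⁻¹ *
    Real.exp (-((x ^ 2 + y ^ 2) / 2) + (2 * t * x * y - t ^ 2 * (x ^ 2 + y ^ 2)) / (1 - t ^ 2))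

/-- **Mehler's formula**. -/
theorem hasSum_eigenfunction_mul {t : ℝ} (ht0 : 0 ≤ t) (ht1 : t < 1) (x y : ℝ) :
    HasSum (fun k : ℕ => (t : ℂ) ^ k * (eigenfunction k x * eigenfunction k y))
      (mehlerKernel t x y : ℂ) := by
  have h := (hasSum_monicHermite_mul ht0 ht1 x y).mul_left
    ((Real.sqrt Real.pi)⁻¹ * Real.exp (-((x ^ 2 + y ^ 2) / 2)))
  have h1 := Complex.hasSum_ofReal.mpr h
  convert! h1 using 1
  · funext k
    have hexp : Real.exp (-((x ^ 2 + y ^ 2) / 2)) =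
        Real.exp (-(x ^ 2 / 2)) * Real.exp (-(y ^ 2 / 2)) := by
      rw [← Real.exp_add]
      ring_nf
    have h2 : hermiteNorm k * (monicHermite k x * Real.exp (-(x ^ 2 / 2))) *
        (hermiteNorm k * (monicHermite k y * Real.exp (-(y ^ 2 / 2)))) =
        hermiteNorm k * hermiteNorm k * (monicHermite k x * monicHermite k y) *
          (Real.exp (-(x ^ 2 / 2)) * Real.exp (-(y ^ 2 / 2))) := by ring
    rw [eigenfunction_apply, eigenfunction_apply, ← Complex.ofReal_pow, ← Complex.ofReal_mul,
      ← Complex.ofReal_mul, h2, hermiteNorm_sq, hexp, mul_pow]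
    congr 1
    ring
  · rw [mehlerKernel, Real.exp_add]
    congr 1
    ring

/-! ### Normalisation of the eigenfunctions -/

theorem conj_eigenfunction (k : ℕ) (x : ℝ) :
    (starRingEnd ℂ) (eigenfunction k x) = eigenfunction k x := by
  rw [eigenfunction_apply, Complex.conj_ofReal]

theorem integrable_schwartz_mul (f g : 𝓢(ℝ, ℂ)) : Integrable fun x => f x * g x :=
  (f.memLp 2 volume).integrable_mul (g.memLp 2 volume)

/-- Integration by parts: for the bilinear pairing, `x + d/dx` is the transpose of `x - d/dx`. -/
theorem integral_creation_mul (f g : 𝓢(ℝ, ℂ)) :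
    ∫ x, creation f x * g x = ∫ x, f x * (position g x + ddx g x) := by
  have h1 : ∀ x, creation f x * g x = position f x * g x - ddx f x * g x := by
    intro x
    rw [← sub_mul]
    rfl
  have h2 : ∀ x, f x * (position g x + ddx g x) = position f x * g x + f x * ddx g x := by
    intro x
    rw [position_apply, position_apply]
    ring
  simp only [h1, h2]
  rw [integral_sub (integrable_schwartz_mul _ _) (integrable_schwartz_mul _ _),
    integral_add (integrable_schwartz_mul _ _) (integrable_schwartz_mul _ _)]
  have := SchwartzMap.integral_mul_deriv_eq_neg_deriv_mul f g
  simp only [ddx_apply]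
  rw [this, sub_eq_add_neg]

theorem annihilation_creation (f : 𝓢(ℝ, ℂ)) :
    position (creation f) + ddx (creation f) = oscillator f + f := by
  change position (position f - ddx f) + ddx (position f - ddx f) =
    (-ddx (ddx f) + position (position f)) + f
  simp only [map_sub, ddx_position]
  abel

/-- Since `A A* = H + 1`, moving `A*` across the integral multiplies the previous one by `2k + 2`,
which the normalising constant cancels. Of the Hilbert space geometry of the `ψ_k`, only this unit
norm is needed below. -/
theorem integral_eigenfunction_mul_self (k : ℕ) :
    ∫ x, eigenfunction k x * eigenfunction k x = 1 := by
  induction k with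
  | zero =>
    have h : ∀ x, eigenfunction 0 x * eigenfunction 0 x =
        (((Real.sqrt Real.pi)⁻¹ * Real.exp (-1 * x ^ 2) : ℝ) : ℂ) := by
      intro x
      have h1 := hermiteNorm_sq 0
      rw [eigenfunction_apply, ← Complex.ofReal_mul, mul_mul_mul_comm, h1]
      simp only [monicHermite, pow_zero, Nat.factorial_zero, Nat.cast_one, div_one, mul_one, one_mul]
      rw [← Real.exp_add]
      ring_nf
    simp only [h]
    rw [integral_complex_ofReal, integral_const_mul, integral_gaussian, div_one,
      inv_mul_cancel₀ (Real.sqrt_ne_zero'.mpr Real.pi_pos), Complex.ofReal_one]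
  | succ k ih =>
    set c : ℝ := (2 * ((k : ℝ) + 1)) ^ (-(1 / 2) : ℝ) with hc
    have hcc : c * c = (2 * ((k : ℝ) + 1))⁻¹ := by
      rw [hc, ← Real.rpow_add (by positivity), ← Real.rpow_neg_one]
      norm_num
    have h : ∀ x, eigenfunction (k + 1) x * eigenfunction (k + 1) x =
        ((c * c : ℝ) : ℂ) * (creation (eigenfunction k) x * creation (eigenfunction k) x) := by
      intro x
      rw [eigenfunction]
      change (c : ℂ) * creation (eigenfunction k) x * ((c : ℂ) * creation (eigenfunction k) x) = _
      push_cast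
      ring
    have h2 : ∀ x, eigenfunction k x * (position (creation (eigenfunction k)) x +
        ddx (creation (eigenfunction k)) x) =
        (2 * ((k : ℂ) + 1)) * (eigenfunction k x * eigenfunction k x) := by
      intro x
      have h3 := congrArg (fun f : 𝓢(ℝ, ℂ) => f x) (annihilation_creation (eigenfunction k))
      rw [oscillator_eigenfunction] at h3
      change position (creation (eigenfunction k)) x + ddx (creation (eigenfunction k)) x =
        (2 * (k : ℂ) + 1) * eigenfunction k x + eigenfunction k x at h3
      rw [h3]
      ring
    simp only [h]
    rw [integral_const_mul, integral_creation_mul]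
    simp only [h2]
    rw [integral_const_mul, ih, hcc]
    have : (k : ℂ) + 1 ≠ 0 := by exact_mod_cast k.succ_ne_zero
    push_cast
    field_simp

theorem inner_eigenvector_self (k : ℕ) : inner ℂ (eigenvector k) (eigenvector k) = (1 : ℂ) := by
  rw [eigenvector, SchwartzMap.inner_toL2_toL2_eq _ _ volume, ← integral_eigenfunction_mul_self k]
  congr 1
  funext x
  rw [RCLike.inner_apply, conj_eigenfunction]

theorem norm_eigenvector (k : ℕ) : ‖eigenvector k‖ = 1 := by
  have h := inner_eigenvector_self k
  rw [@norm_eq_sqrt_re_inner ℂ, h]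
  simp

theorem norm_eigenfunction_mul_self (k : ℕ) (x : ℝ) :
    ((‖eigenfunction k x‖ ^ 2 : ℝ) : ℂ) = eigenfunction k x * eigenfunction k x := by
  have := Complex.conj_mul' (eigenfunction k x)
  rw [conj_eigenfunction] at this
  rw [this]
  push_cast
  rfl

theorem integral_norm_eigenfunction_sq (k : ℕ) : ∫ x, ‖eigenfunction k x‖ ^ 2 = 1 := by
  have h : ∫ x, ((‖eigenfunction k x‖ ^ 2 : ℝ) : ℂ) = 1 := by
    simp only [norm_eigenfunction_mul_self]
    exact integral_eigenfunction_mul_self k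
  rw [integral_complex_ofReal] at h
  exact_mod_cast h

theorem integrable_norm_eigenfunction_sq (k : ℕ) :
    Integrable fun x => ‖eigenfunction k x‖ ^ 2 :=
  ((eigenfunction k).memLp 2 volume).integrable_norm_pow (by norm_num)

/-- A bound uniform in `k`, from `2ab ≤ a² + b²` and translation invariance. It makes the Abel
series converge geometrically in `L¹`. -/
theorem integral_norm_eigenfunction_mul_le (k : ℕ) (q : ℝ) :
    Integrable (fun x => ‖eigenfunction k x‖ * ‖eigenfunction k (x - q)‖) ∧
    ∫ x, ‖eigenfunction k x‖ * ‖eigenfunction k (x - q)‖ ≤ 1 := by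
  have h1 := integrable_norm_eigenfunction_sq k
  have h2 := h1.comp_sub_right q
  have hle : ∀ x, ‖eigenfunction k x‖ * ‖eigenfunction k (x - q)‖ ≤
      (1 / 2) * (‖eigenfunction k x‖ ^ 2 + ‖eigenfunction k (x - q)‖ ^ 2) := by
    intro x
    nlinarith [sq_nonneg (‖eigenfunction k x‖ - ‖eigenfunction k (x - q)‖)]
  have hi : Integrable (fun x => ‖eigenfunction k x‖ * ‖eigenfunction k (x - q)‖) := by
    refine Integrable.mono' ((h1.add h2).const_mul (1 / 2)) ?_ (Eventually.of_forall fun x => ?_)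
    · have := (eigenfunction k).continuous
      fun_prop
    · rw [Real.norm_of_nonneg (by positivity)]
      exact hle x
  refine ⟨hi, (integral_mono hi ((h1.add h2).const_mul (1 / 2)) hle).trans_eq ?_⟩
  simp only [Pi.add_apply]
  rw [integral_const_mul, integral_add h1 h2,
    integral_sub_right_eq_self (fun x => ‖eigenfunction k x‖ ^ 2) q,
    integral_norm_eigenfunction_sq]
  norm_num

/-! ### Abel sums of diagonal matrix coefficients -/

theorem hasSum_integral_mul_eigenfunction {t : ℝ} (ht0 : 0 ≤ t) (ht1 : t < 1) (q : ℝ)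
    {g : ℝ → ℂ} (hg : AEStronglyMeasurable g) {C : ℝ} (hC : ∀ x, ‖g x‖ ≤ C) :
    HasSum (fun k : ℕ => (t : ℂ) ^ k * ∫ x, g x * (eigenfunction k x * eigenfunction k (x - q)))
      (∫ x, g x * mehlerKernel t x (x - q)) := by
  have hb : ∀ k x, ‖(t : ℂ) ^ k * (g x * (eigenfunction k x * eigenfunction k (x - q)))‖ ≤
      t ^ k * C * (‖eigenfunction k x‖ * ‖eigenfunction k (x - q)‖) := by
    intro k x
    rw [norm_mul, norm_mul, norm_mul, norm_pow, Complex.norm_real, Real.norm_of_nonneg ht0,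
      ← mul_assoc]
    gcongr
    exact hC x
  have hC0 : 0 ≤ C := (norm_nonneg _).trans (hC 0)
  have hinteg : ∀ k, Integrable fun x =>
      (t : ℂ) ^ k * (g x * (eigenfunction k x * eigenfunction k (x - q))) := by
    intro k
    refine Integrable.mono' ((integral_norm_eigenfunction_mul_le k q).1.const_mul (t ^ k * C)) ?_
      (Eventually.of_forall (hb k))
    have := (eigenfunction k).continuous
    exact (hg.mul (by fun_prop)).const_mul _
  have h := hasSum_integral_of_summable_integral_norm hinteg ?_
  · simp only [integral_const_mul] at h
    convert! h using 2
    funext x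
    have := (hasSum_eigenfunction_mul ht0 ht1 x (x - q)).mul_left (g x)
    rw [← this.tsum_eq]
    congr 1
    funext k
    ring
  · refine Summable.of_nonneg_of_le (fun k => integral_nonneg fun x => norm_nonneg _) (fun k => ?_)
      ((summable_geometric_of_lt_one ht0 ht1).mul_right C)
    refine (integral_mono (hinteg k).norm
      ((integral_norm_eigenfunction_mul_le k q).1.const_mul (t ^ k * C)) (hb k)).trans ?_
    rw [integral_const_mul]
    exact mul_le_of_le_one_right (by positivity) (integral_norm_eigenfunction_mul_le k q).2

theorem ofReal_mehlerKernel_sub {t : ℝ} (ht0 : 0 ≤ t) (ht1 : t < 1) (p q x : ℝ) :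
    cexp (p * x * I) * mehlerKernel t x (x - q) =
      (((Real.sqrt Real.pi)⁻¹ * (Real.sqrt (1 - t ^ 2))⁻¹ : ℝ) : ℂ) *
      cexp ((-((1 - t) / (1 + t)) : ℝ) * x ^ 2 + (q * ((1 - t) / (1 + t)) + p * I) * x +
        (-(q ^ 2 * (1 + t ^ 2) / (2 * (1 - t ^ 2))) : ℝ)) := by
  have h1 : (1 - t) ≠ 0 := by linarith
  have h2 : (1 + t) ≠ 0 := by linarith
  have h3 : 1 - t ^ 2 = (1 - t) * (1 + t) := by ring
  have hex : -((x ^ 2 + (x - q) ^ 2) / 2) +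
      (2 * t * x * (x - q) - t ^ 2 * (x ^ 2 + (x - q) ^ 2)) / (1 - t ^ 2) =
      -((1 - t) / (1 + t)) * x ^ 2 + q * ((1 - t) / (1 + t)) * x +
        -(q ^ 2 * (1 + t ^ 2) / (2 * (1 - t ^ 2))) := by
    rw [h3]
    field_simp
    ring
  rw [mehlerKernel, hex, Complex.ofReal_mul, mul_left_comm, Complex.ofReal_exp, ← Complex.exp_add]
  congr 2
  push_cast
  ring

theorem integrable_mehlerKernel_sub {t : ℝ} (ht0 : 0 ≤ t) (ht1 : t < 1) (q : ℝ) :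
    Integrable fun x => mehlerKernel t x (x - q) := by
  have hre : ((-((1 - t) / (1 + t)) : ℝ) : ℂ).re < 0 := by
    rw [Complex.ofReal_re, neg_lt_zero]
    exact div_pos (by linarith) (by linarith)
  have h := (integrable_cexp_quadratic' hre (q * ((1 - t) / (1 + t)) + (0 : ℝ) * I)
    (-(q ^ 2 * (1 + t ^ 2) / (2 * (1 - t ^ 2))) : ℝ)).const_mul
    (((Real.sqrt Real.pi)⁻¹ * (Real.sqrt (1 - t ^ 2))⁻¹ : ℝ) : ℂ)
  simp only [← ofReal_mehlerKernel_sub ht0 ht1 0 q] at h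
  simpa using h.re

/-- A Gaussian integral with leading coefficient `-(1-t)/(1+t)`. The modulus of the result is
symmetric in `p` and `q`, in accordance with the Fourier invariance of `H`. -/
theorem integral_exp_mul_mehlerKernel {t : ℝ} (ht0 : 0 ≤ t) (ht1 : t < 1) (p q : ℝ) :
    ∫ x : ℝ, cexp (p * x * I) * mehlerKernel t x (x - q) =
      cexp (p * q / 2 * I) *
        (((1 - t)⁻¹ * Real.exp (-((p ^ 2 + q ^ 2) / 4 * ((1 + t) / (1 - t)))) : ℝ) : ℂ) := by
  have h1 : 0 < 1 - t := by linarith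
  have h2 : 0 < 1 + t := by linarith
  have h1' : (1 - t : ℂ) ≠ 0 := by exact_mod_cast h1.ne'
  have h2' : (1 + t : ℂ) ≠ 0 := by exact_mod_cast h2.ne'
  have h3 : 1 - t ^ 2 = (1 - t) * (1 + t) := by ring
  have h3' : 1 - (t : ℂ) ^ 2 = (1 - t) * (1 + t) := by ring
  have hre : ((-((1 - t) / (1 + t)) : ℝ) : ℂ).re < 0 := by
    rw [Complex.ofReal_re, neg_lt_zero]
    exact div_pos h1 h2
  simp only [ofReal_mehlerKernel_sub ht0 ht1]
  rw [integral_const_mul, integral_cexp_quadratic hre]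
  have hroot : ((Real.pi : ℂ) / -((-((1 - t) / (1 + t)) : ℝ) : ℂ)) ^ (1 / 2 : ℂ) =
      ((Real.sqrt (Real.pi * ((1 + t) / (1 - t))) : ℝ) : ℂ) := by
    rw [Real.sqrt_eq_rpow, Complex.ofReal_cpow (by positivity)]
    congr 1
    · push_cast
      rw [neg_neg]
      field_simp
    · norm_num
  have hconst : (Real.sqrt Real.pi)⁻¹ * (Real.sqrt (1 - t ^ 2))⁻¹ *
      Real.sqrt (Real.pi * ((1 + t) / (1 - t))) = (1 - t)⁻¹ := by
    rw [← mul_inv, ← Real.sqrt_mul Real.pi_pos.le, ← Real.sqrt_inv, ← Real.sqrt_mul (by rw [h3]; positivity), h3,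
      ← Real.sqrt_sq (inv_nonneg.mpr h1.le)]
    congr 1
    have := Real.pi_pos
    field_simp
  rw [hroot, ← mul_assoc, ← Complex.ofReal_mul, hconst, Complex.ofReal_mul, mul_left_comm,
    Complex.ofReal_exp, ← Complex.exp_add]
  congr 2
  push_cast
  rw [h3']
  field_simp
  ring_nf
  simp only [I_sq]
  ring

/-- The kernel is nonnegative, so `g` costs only its bound and what remains is the case `p = 0`
above. -/
theorem norm_integral_mul_mehlerKernel_le {t : ℝ} (ht0 : 0 ≤ t) (ht1 : t < 1) (q : ℝ)
    {g : ℝ → ℂ} {C : ℝ} (hC : ∀ x, ‖g x‖ ≤ C) :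
    ‖∫ x, g x * mehlerKernel t x (x - q)‖ ≤
      C * ((1 - t)⁻¹ * Real.exp (-(q ^ 2 / 4 * ((1 + t) / (1 - t))))) := by
  have h0 : ∀ x, 0 ≤ mehlerKernel t x (x - q) := fun x => by
    unfold mehlerKernel
    positivity
  refine (norm_integral_le_of_norm_le ((integrable_mehlerKernel_sub ht0 ht1 q).const_mul C)
    (Eventually.of_forall fun x => ?_)).trans_eq ?_
  · rw [norm_mul, Complex.norm_real, Real.norm_of_nonneg (h0 x)]
    exact mul_le_mul_of_nonneg_right (hC x) (h0 x)
  · rw [integral_const_mul]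
    have h := integral_exp_mul_mehlerKernel ht0 ht1 0 q
    simp only [Complex.ofReal_zero, zero_mul, zero_div, Complex.exp_zero, one_mul,
      integral_complex_ofReal] at h
    rw [Complex.ofReal_inj.mp h]
    simp

/-! ### Traces of nuclear operators -/

theorem summable_norm_inner_mul_inner {ι : Type*} (e : HilbertBasis ι ℂ L2R) (x y : L2R) :
    Summable (fun i => ‖inner ℂ y (e i) * inner ℂ (e i) x‖) ∧
      ∑' i, ‖inner ℂ y (e i) * inner ℂ (e i) x‖ ≤ ‖x‖ * ‖y‖ := by
  have hs : Summable (fun i => ‖inner ℂ y (e i) * inner ℂ (e i) x‖) :=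
    (e.summable_inner_mul_inner y x).norm
  refine ⟨hs, hs.tsum_le_of_sum_le fun s => ?_⟩
  have hx := e.orthonormal.sum_inner_products_le x (s := s)
  have hy := e.orthonormal.sum_inner_products_le y (s := s)
  have hcs := Finset.sum_mul_sq_le_sq_mul_sq s (fun i => ‖inner ℂ (e i) y‖)
    (fun i => ‖inner ℂ (e i) x‖)
  have h1 : ∑ i ∈ s, ‖inner ℂ y (e i) * inner ℂ (e i) x‖ =
      ∑ i ∈ s, ‖inner ℂ (e i) y‖ * ‖inner ℂ (e i) x‖ :=
    Finset.sum_congr rfl fun i _ => by rw [norm_mul, norm_inner_symm]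
  rw [h1]
  refine abs_le_of_sq_le_sq' ?_ (by positivity) |>.2
  refine hcs.trans ((mul_le_mul hy hx (by positivity) (by positivity)).trans_eq (by ring))

/-- The trace of a nuclear operator `∑ ⟨y_n, ·⟩ x_n` is `∑ ⟨y_n, x_n⟩`. -/
theorem hasTrace_of_hasSum_rankOne {T : Op} {x y : ℕ → L2R} {c : ℂ}
    (hs : Summable fun n => ‖x n‖ * ‖y n‖)
    (hT : HasSum (fun n => InnerProductSpace.rankOne ℂ (x n) (y n)) T)
    (hc : HasSum (fun n => inner ℂ (y n) (x n)) c) : HasTrace T c := by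
  refine ⟨⟨x, y, hs, hT⟩, fun ι e => ?_⟩
  -- Absolute convergence of the double family permits both orders: over `i` first, Parseval gives
  -- `⟨y_n, x_n⟩`; over `n` first, the sum is `⟨e_i, T e_i⟩`.
  have hsum : Summable fun p : ℕ × ι => inner ℂ (y p.1) (e p.2) * inner ℂ (e p.2) (x p.1) := by
    refine Summable.of_norm ((summable_prod_of_nonneg fun p => norm_nonneg _).mpr
      ⟨fun n => (summable_norm_inner_mul_inner e (x n) (y n)).1, ?_⟩)
    exact Summable.of_nonneg_of_le (fun n => tsum_nonneg fun i => norm_nonneg _)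
      (fun n => (summable_norm_inner_mul_inner e (x n) (y n)).2) hs
  have h1 : HasSum (fun p : ℕ × ι => inner ℂ (y p.1) (e p.2) * inner ℂ (e p.2) (x p.1)) c := by
    have h := hsum.hasSum
    have h' := h.prod_fiberwise fun n => e.hasSum_inner_mul_inner (y n) (x n)
    rwa [h'.unique hc] at h
  have h2 := ((Equiv.prodComm ι ℕ).hasSum_iff.mpr h1).prod_fiberwise (g := fun i =>
    inner ℂ (e i) (T (e i))) fun i => ?_
  · exact h2
  · have h3 := hT.mapL ((innerSL ℂ (e i)) ∘L (ContinuousLinearMap.apply ℂ L2R (e i)))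
    convert! h3 using 2 with n
    change _ = inner ℂ (e i) (inner ℂ (y n) (e i) • x n)
    rw [inner_smul_right]
    rfl

theorem norm_two_mul_add_one_cpow (k : ℕ) (s : ℂ) :
    ‖(2 * (k : ℂ) + 1) ^ (-s)‖ = 1 / (2 * (k : ℝ) + 1) ^ s.re := by
  have h : (2 * (k : ℂ) + 1) = ((2 * (k : ℝ) + 1 : ℝ) : ℂ) := by push_cast; rfl
  rw [h, Complex.norm_cpow_eq_rpow_re_of_pos (by positivity), Complex.neg_re,
    Real.rpow_neg (by positivity), one_div]

theorem summable_one_div_two_mul_add_one_rpow {σ : ℝ} (hσ : 1 < σ) :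
    Summable fun k : ℕ => 1 / (2 * (k : ℝ) + 1) ^ σ := by
  have h := (Real.summable_one_div_nat_rpow.mpr hσ).comp_injective
    (i := fun k : ℕ => 2 * k + 1) (fun a b h => by simpa using h)
  refine h.congr fun k => ?_
  simp

/-- The trace of `T H^{-s}` is `∑ (2k + 1)^{-s} ⟨ψ_k, T ψ_k⟩`. -/
theorem hasTrace_mul_oscillatorPow (T : Op) {s c : ℂ} (hs : 1 < s.re)
    (hc : HasSum (fun k : ℕ =>
      (2 * (k : ℂ) + 1) ^ (-s) * inner ℂ (eigenvector k) (T (eigenvector k))) c) :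
    HasTrace (T * oscillatorPow s) c := by
  have hsum := summable_one_div_two_mul_add_one_rpow hs
  have hpow : HasSum (fun k : ℕ => (2 * (k : ℂ) + 1) ^ (-s) •
      InnerProductSpace.rankOne ℂ (eigenvector k) (eigenvector k)) (oscillatorPow s) := by
    refine (Summable.of_norm (hsum.congr fun k => ?_)).hasSum
    rw [norm_smul, InnerProductSpace.norm_rankOne, norm_eigenvector, norm_two_mul_add_one_cpow]
    ring
  refine hasTrace_of_hasSum_rankOne
    (x := fun k => (2 * (k : ℂ) + 1) ^ (-s) • T (eigenvector k)) (y := eigenvector) ?_ ?_ ?_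
  · refine Summable.of_nonneg_of_le (fun k => by positivity) (fun k => ?_) (hsum.mul_right ‖T‖)
    rw [norm_smul, norm_eigenvector, norm_two_mul_add_one_cpow, mul_one]
    gcongr
    simpa [norm_eigenvector] using T.le_opNorm (eigenvector k)
  · have h := hpow.mapL (ContinuousLinearMap.mul ℂ Op T)
    convert! h using 2 with k
    refine ContinuousLinearMap.ext fun ξ => ?_
    change inner ℂ (eigenvector k) ξ • ((2 * (k : ℂ) + 1) ^ (-s) • T (eigenvector k)) =
      T ((2 * (k : ℂ) + 1) ^ (-s) • (inner ℂ (eigenvector k) ξ • eigenvector k))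
    rw [map_smul, map_smul, smul_comm]
  · simpa only [inner_smul_right] using hc

/-! ### Dirichlet series with rapidly decaying Abel sums -/

/-- From `e^w ≥ w^{N+1} / (N+1)!` at `w = r/z`; the additional power absorbs `z⁻¹`. -/
theorem inv_mul_exp_neg_div_le {r z : ℝ} (hr : 0 < r) (hz : 0 < z) (N : ℕ) :
    z⁻¹ * Real.exp (-(r / z)) ≤ (N + 1).factorial / r ^ (N + 1) * z ^ N := by
  have h := Real.pow_div_factorial_le_exp (r / z) (by positivity) (N + 1)
  rw [Real.exp_neg, ← mul_inv, inv_le_comm₀ (by positivity) (by positivity)]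
  calc ((N + 1).factorial / r ^ (N + 1) * z ^ N)⁻¹ =
        z * ((r / z) ^ (N + 1) / (N + 1).factorial) := by
        rw [div_pow, pow_succ z]
        field_simp
    _ ≤ _ := by gcongr

/-- If the Abel sums of a bounded sequence `a` are `O((1 - t)⁻¹ e^{-r / (1 - t)})`, then the
Dirichlet series `∑ a_k (2k + 1)^{-s}` extends to an entire function. -/
theorem exists_entire_of_abel_bound {a : ℕ → ℂ} {B r C : ℝ} (hB : ∀ k, ‖a k‖ ≤ B) (hr : 0 < r)
    {A : ℝ → ℂ} (hA : ∀ t : ℝ, 0 ≤ t → t < 1 → HasSum (fun k => (t : ℂ) ^ k * a k) (A t))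
    (hAC : ∀ t : ℝ, 0 ≤ t → t < 1 → ‖A t‖ ≤ C * ((1 - t)⁻¹ * Real.exp (-(r / (1 - t))))) :
    ∃ F : ℂ → ℂ, Differentiable ℂ F ∧ ∀ s : ℂ, 1 < s.re →
      HasSum (fun k : ℕ => (2 * (k : ℂ) + 1) ^ (-s) * a k) (F s) := by
  have hC0 : 0 ≤ C := by
    have := (norm_nonneg _).trans (hAC 0 le_rfl one_pos)
    exact nonneg_of_mul_nonneg_left this (by positivity)
  -- The heat trace, equal to `e^{-y} A(e^{-2y})`.
  set θ : ℝ → ℂ := fun y => ∑' k : ℕ, a k * ((Real.exp (-(2 * (k : ℝ) + 1) * y) : ℝ) : ℂ) with hθ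
  have hexp : ∀ y : ℝ, 0 < y → Real.exp (-2 * y) < 1 := fun y hy => by
    rw [Real.exp_lt_one_iff]
    linarith
  have hsum : ∀ y : ℝ, 0 < y →
      HasSum (fun k : ℕ => a k * ((Real.exp (-(2 * (k : ℝ) + 1) * y) : ℝ) : ℂ))
        (((Real.exp (-y) : ℝ) : ℂ) * A (Real.exp (-2 * y))) := by
    intro y hy
    convert! (hA _ (Real.exp_pos _).le (hexp y hy)).mul_left ((Real.exp (-y) : ℝ) : ℂ) using 2
      with k
    rw [← Complex.ofReal_pow, ← Real.exp_nat_mul, ← mul_assoc, ← Complex.ofReal_mul,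
      ← Real.exp_add, mul_comm (a k)]
    ring_nf
  have hθA : ∀ y : ℝ, 0 < y → θ y = ((Real.exp (-y) : ℝ) : ℂ) * A (Real.exp (-2 * y)) :=
    fun y hy => (hsum y hy).tsum_eq
  have hbound : ∀ (N : ℕ) (y : ℝ), 0 < y → ‖θ y‖ ≤
      C * ((N + 1).factorial / r ^ (N + 1) * (2 * y) ^ N) * Real.exp (-y) := by
    intro N y hy
    have h1 := hexp y hy
    rw [hθA y hy, norm_mul, Complex.norm_real, Real.norm_of_nonneg (Real.exp_pos _).le, mul_comm]
    gcongr
    refine (hAC _ (Real.exp_pos _).le h1).trans (mul_le_mul_of_nonneg_left ?_ hC0)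
    refine (inv_mul_exp_neg_div_le hr (sub_pos.mpr h1) N).trans ?_
    -- This gives `1 - e^{-2y} ≤ 2y`, turning decay in `1 - t` into decay in `y`.
    have h2 := Real.add_one_le_exp (-2 * y)
    gcongr
    linarith
  have hmeas : Measurable θ := by
    refine Measurable.tsum fun k => ?_
    fun_prop
  have hinteg : IntegrableOn θ (Set.Ioi 0) := by
    refine Integrable.mono' ((exp_neg_integrableOn_Ioi 0 one_pos).const_mul
      (C * ((0 + 1).factorial / r ^ (0 + 1)))) hmeas.aestronglyMeasurable ?_
    filter_upwards [ae_restrict_mem measurableSet_Ioi] with y hy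
    simpa using hbound 0 y hy
  have htop : θ =O[atTop] fun y => Real.exp (-1 * y) := by
    refine Asymptotics.IsBigO.of_bound (C * ((0 + 1).factorial / r ^ (0 + 1))) ?_
    filter_upwards [eventually_gt_atTop 0] with y hy
    rw [Real.norm_of_nonneg (Real.exp_pos _).le]
    simpa using hbound 0 y hy
  have hbot : ∀ N : ℕ, θ =O[𝓝[>] 0] fun y => y ^ (-(-(N : ℝ))) := by
    intro N
    refine Asymptotics.IsBigO.of_bound (C * ((N + 1).factorial / r ^ (N + 1) * 2 ^ N)) ?_
    filter_upwards [self_mem_nhdsWithin] with y hy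
    have hy0 : (0 : ℝ) < y := hy
    rw [neg_neg, Real.rpow_natCast, Real.norm_of_nonneg (by positivity)]
    refine (hbound N y hy0).trans ?_
    calc _ ≤ C * ((N + 1).factorial / r ^ (N + 1) * (2 * y) ^ N) * 1 := by
          gcongr
          exact Real.exp_le_one_iff.mpr (by linarith)
      _ = _ := by
          rw [mul_pow]
          ring
  refine ⟨fun s => (Gamma s)⁻¹ * mellin θ s, differentiable_one_div_Gamma.mul fun s => ?_,
    fun s hs => ?_⟩
  -- Vanishing to order `N` at `0` makes the Mellin transform holomorphic for `Re s > -N`, and `N`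
  -- is arbitrary.
  · obtain ⟨N, hN⟩ := exists_nat_gt (-s.re)
    exact mellin_differentiableAt_of_isBigO_rpow_exp one_pos hinteg.locallyIntegrableOn htop (hbot N)
      (by linarith)
  · have hpos : 0 < s.re := by linarith
    have h := hasSum_mellin (a := a) (p := fun k : ℕ => 2 * (k : ℝ) + 1) (F := θ) (s := s)
      (fun k => Or.inr (by positivity)) hpos
      (fun y hy => by
        rw [hθA y hy]
        exact hsum y hy)
      (Summable.of_nonneg_of_le (fun k => by positivity)
        (fun k => by
          rw [div_eq_mul_one_div]
          exact mul_le_mul_of_nonneg_right (hB k) (by positivity))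
        ((summable_one_div_two_mul_add_one_rpow hs).mul_left B))
    have h' := h.mul_left (Gamma s)⁻¹
    convert! h' using 2 with k
    have hG : Gamma s ≠ 0 := Gamma_ne_zero_of_re_pos hpos
    rw [Complex.cpow_neg]
    push_cast
    field_simp

/-- The even terms of the zeta series sum to `2^{-s} ζ(s)`; removing them leaves the odd ones. -/
theorem hasSum_odd_zeta {s : ℂ} (hs : 1 < s.re) :
    HasSum (fun k : ℕ => (2 * (k : ℂ) + 1) ^ (-s)) ((1 - 2 ^ (-s)) * riemannZeta s) := by
  obtain ⟨c, hc⟩ : Summable fun k : ℕ => (2 * (k : ℂ) + 1) ^ (-s) :=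
    Summable.of_norm ((summable_one_div_two_mul_add_one_rpow hs).congr fun k =>
      (norm_two_mul_add_one_cpow k s).symm)
  have hall : HasSum (fun n : ℕ => 1 / (n : ℂ) ^ s) (riemannZeta s) := by
    rw [zeta_eq_tsum_one_div_nat_cpow hs]
    exact (Complex.summable_one_div_nat_cpow.mpr hs).hasSum
  have heven_term : ∀ k : ℕ, 2 ^ (-s) * (1 / (k : ℂ) ^ s) = 1 / ((2 * k : ℕ) : ℂ) ^ s := by
    intro k
    have h : ((2 * k : ℕ) : ℂ) = ((2 : ℝ) : ℂ) * ((k : ℝ) : ℂ) := by push_cast; rfl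
    rw [h, Complex.mul_cpow_ofReal_nonneg (by norm_num) (by positivity), Complex.cpow_neg,
      one_div, one_div, mul_inv]
    push_cast
    rfl
  have heven := hall.mul_left (2 ^ (-s))
  simp only [heven_term] at heven
  have hodd_term : ∀ k : ℕ, (2 * (k : ℂ) + 1) ^ (-s) = 1 / ((2 * k + 1 : ℕ) : ℂ) ^ s := by
    intro k
    rw [Complex.cpow_neg, one_div]
    push_cast
    rfl
  have hodd := hc
  simp only [hodd_term] at hodd
  have h := (HasSum.even_add_odd (f := fun n : ℕ => 1 / (n : ℂ) ^ s) heven hodd).unique hall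
  have h' : c = (1 - 2 ^ (-s)) * riemannZeta s := by
    rw [sub_mul, one_mul]
    exact eq_sub_of_add_eq' h
  rw [← h']
  exact hc

/-! ### Monomials `u^n v^m` in a phase and a translation -/

theorem zpow_eq_of_map_add {G : Type*} [Group G] (f : ℤ → G) (hf : ∀ m n, f (m + n) = f m * f n)
    (n : ℤ) : f 1 ^ n = f n := by
  let φ : Multiplicative ℤ →* G := MonoidHom.mk' (fun m => f m.toAdd) fun a b => hf _ _
  have h := map_zpow φ (Multiplicative.ofAdd 1) n
  rw [← ofAdd_zsmul] at h
  simpa [φ] using h.symm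

theorem translation_zpow (α : ℝ) (n : ℤ) : translation α ^ n = translation (n * α) := by
  have h := zpow_eq_of_map_add (fun n : ℤ => translation (n * α)) (fun m n => ?_) n
  · simpa using h
  · refine LinearIsometryEquiv.ext fun ξ => Lp.ext ?_
    change translation _ ξ =ᵐ[volume] translation _ (translation _ ξ)
    have h1 := (measurePreserving_sub_right (volume : Measure ℝ)
      (m * α)).quasiMeasurePreserving.ae (coeFn_translation (n * α) ξ)
    filter_upwards [coeFn_translation (((m + n : ℤ) : ℝ) * α) ξ, h1,
      coeFn_translation (m * α) (translation (n * α) ξ)] with x h2 h3 h4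
    rw [h2, h4, h3]
    congr 1
    push_cast
    ring

theorem phaseOp_zpow (g : ℝ → ℝ) (hg : Measurable g) (n : ℤ) :
    phaseOp g hg ^ n = phaseOp (fun x => n * g x) (hg.const_mul _) := by
  have h := zpow_eq_of_map_add
    (fun n : ℤ => phaseOp (fun x => n * g x) (hg.const_mul _)) (fun m n => ?_) n
  · simpa using h
  · refine LinearIsometryEquiv.ext fun ξ => Lp.ext ?_
    change phaseOp _ (hg.const_mul _) ξ =ᵐ[volume]
      phaseOp _ (hg.const_mul _) (phaseOp _ (hg.const_mul _) ξ)
    filter_upwards [coeFn_phaseOp (fun x => ((m + n : ℤ) : ℝ) * g x) (hg.const_mul _) ξ,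
      coeFn_phaseOp (fun x => (n : ℝ) * g x) (hg.const_mul _) ξ,
      coeFn_phaseOp (fun x => (m : ℝ) * g x) (hg.const_mul _)
        (phaseOp (fun x => (n : ℝ) * g x) (hg.const_mul _) ξ)] with x h1 h2 h3
    rw [h1, h3, h2, ← mul_assoc, ← exp_add]
    congr 2
    push_cast
    ring

/-- The operator `u^n v^m` of a covariant pair `(u, v)`. -/
def monomialOp {ħ : ℝ} (i : CovariantPair ħ) (p : ℤ × ℤ) : Op :=
  ((i.1.1 ^ p.1 : unitary Op) : Op) * ((i.1.2 ^ p.2 : unitary Op) : Op)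

theorem coeFn_monomialOp {ħ α : ℝ} {g : ℝ → ℝ} (hg : Measurable g) (i : CovariantPair ħ)
    (hu : i.1.1 = Unitary.linearIsometryEquiv.symm (phaseOp g hg))
    (hv : i.1.2 = Unitary.linearIsometryEquiv.symm (translation α)) (p : ℤ × ℤ) (ξ : L2R) :
    monomialOp i p ξ =ᵐ[volume] fun x => exp (2 * Real.pi * (p.1 * g x) * I) * ξ (x - p.2 * α) := by
  rw [monomialOp, hu, hv, ← map_zpow, ← map_zpow, phaseOp_zpow, translation_zpow]
  change phaseOp _ (hg.const_mul _) (translation _ ξ) =ᵐ[volume] _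
  filter_upwards [coeFn_translation (p.2 * α) ξ,
    coeFn_phaseOp (fun x => (p.1 : ℝ) * g x) (hg.const_mul _) (translation (p.2 * α) ξ)]
    with x h1 h2
  rw [h2, h1]
  push_cast
  rfl

/-- Evaluation of a bounded family of operators at an index. -/
def evalHom (ħ : ℝ) (i : CovariantPair ħ) : BigProduct ħ →⋆* Op where
  toFun a := a i
  map_one' := rfl
  map_mul' _ _ := rfl
  map_star' _ := rfl

theorem coe_familyUnitary_zpow_apply (ħ : ℝ) (w : CovariantPair ħ → unitary Op)
    (i : CovariantPair ħ) (n : ℤ) :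
    ((familyUnitary ħ w ^ n : unitary (BigProduct ħ)) : BigProduct ħ) i =
      ((w i ^ n : unitary Op) : Op) := by
  let φ : unitary (BigProduct ħ) →* unitary Op := (Unitary.map (evalHom ħ i)).toMonoidHom
  have h := map_zpow φ (familyUnitary ħ w) n
  have h1 : φ (familyUnitary ħ w) = w i := Subtype.ext rfl
  rw [h1] at h
  exact congrArg Subtype.val h

/-- A representation given by a covariant pair maps `∑ c_{nm} U^n V^m` to `∑ c_{nm} u^n v^m`. -/
theorem hasSum_repOfPair {ħ : ℝ} (i : CovariantPair ħ) {a : rotationAlgebra ħ} {c : ℤ × ℤ → ℂ}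
    (h : HasSum (fun p : ℤ × ℤ =>
      c p • (((bigU ħ ^ p.1 : unitary (BigProduct ħ)) : BigProduct ħ) *
        ((bigV ħ ^ p.2 : unitary (BigProduct ħ)) : BigProduct ħ))) (a : BigProduct ħ)) :
    HasSum (fun p => c p • monomialOp i p) (repOfPair ħ i a) := by
  have h1 := h.mapL (lp.evalCLM ℂ (fun _ : CovariantPair ħ => Op) ∞ i)
  convert! h1 using 2 with p
  change c p • monomialOp i p = c p •
    (((bigU ħ ^ p.1 : unitary (BigProduct ħ)) : BigProduct ħ) i *
        ((bigV ħ ^ p.2 : unitary (BigProduct ħ)) : BigProduct ħ) i)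
  rw [bigU, bigV, coe_familyUnitary_zpow_apply, coe_familyUnitary_zpow_apply]
  rfl

/-! ### The standard trace -/

theorem coeFn_unitCell : unitCell =ᵐ[volume] (Set.Ico (0 : ℝ) 1).indicator fun _ => (1 : ℂ) :=
  indicatorConstLp_coeFn

/-- The power `v^m` moves `[0, 1)` to `[m, m+1)`, disjoint from it unless `m = 0`. On `[0, 1)` the
floor vanishes, so the phase is `e^{2πinx}`, of mean zero unless `n = 0`. -/
theorem inner_unitCell_monomialOp (ħ : ℝ) (p : ℤ × ℤ) :
    inner ℂ unitCell (monomialOp (regularPair ħ) p unitCell) = if p = 0 then (1 : ℂ) else 0 := by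
  have hmon := coeFn_monomialOp (measurable_regularPhase ħ) (regularPair ħ) rfl rfl p unitCell
  have hshift := (measurePreserving_sub_right (volume : Measure ℝ)
      (p.2 * 1)).quasiMeasurePreserving.ae coeFn_unitCell
  have h1 : inner ℂ unitCell (monomialOp (regularPair ħ) p unitCell) =
      ∫ x in Set.Ico (0 : ℝ) 1, exp (2 * Real.pi * (p.1 * x) * I) *
        (Set.Ico (0 : ℝ) 1).indicator (fun _ => (1 : ℂ)) (x - p.2) := by
    rw [L2.inner_def, ← integral_indicator measurableSet_Ico]
    refine integral_congr_ae ?_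
    filter_upwards [hmon, hshift, coeFn_unitCell] with x h1 h2 h3
    rw [h1, h2, h3, RCLike.inner_apply]
    by_cases hx : x ∈ Set.Ico (0 : ℝ) 1
    · rw [Set.indicator_of_mem hx, Set.indicator_of_mem hx]
      have hfl : ⌊x⌋ = 0 := Int.floor_eq_zero_iff.mpr hx
      have hfr : Int.fract x = x := Int.fract_eq_self.mpr hx
      simp [hfl, hfr]
    · rw [Set.indicator_of_notMem hx, Set.indicator_of_notMem hx]
      simp
  rw [h1]
  obtain ⟨n, m⟩ := p
  by_cases hm : m = 0
  · subst hm
    have h2 : ∫ x in Set.Ico (0 : ℝ) 1, exp (2 * Real.pi * (n * x) * I) *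
        (Set.Ico (0 : ℝ) 1).indicator (fun _ => (1 : ℂ)) (x - (0 : ℤ)) =
        ∫ x in (0 : ℝ)..1, exp (2 * Real.pi * n * I * x) := by
      rw [intervalIntegral.integral_of_le zero_le_one, ← integral_Ico_eq_integral_Ioc]
      refine setIntegral_congr_fun measurableSet_Ico fun x hx => ?_
      simp only [Int.cast_zero, sub_zero]
      rw [Set.indicator_of_mem hx, mul_one]
      ring_nf
    rw [h2]
    by_cases hn : n = 0
    · subst hn
      simp
    · have hne : (2 * Real.pi * n * I : ℂ) ≠ 0 := by
        simp [hn, Real.pi_ne_zero, I_ne_zero]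
      rw [integral_exp_mul_complex hne, if_neg (by simp [hn])]
      have h3 : exp (2 * Real.pi * n * I * (1 : ℝ)) = 1 := by
        rw [Complex.exp_eq_one_iff]
        exact ⟨n, by push_cast; ring⟩
      rw [h3]
      simp
  · rw [if_neg (by simp [hm])]
    refine setIntegral_eq_zero_of_forall_eq_zero fun x hx => ?_
    rw [Set.indicator_of_notMem, mul_zero]
    intro hx'
    have h4 : (m : ℝ) < 1 := by linarith [hx.2, hx'.1]
    have h5 : (-1 : ℝ) < m := by linarith [hx.1, hx'.2]
    have h4' : m < 1 := by exact_mod_cast h4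
    have h5' : -1 < m := by exact_mod_cast h5
    omega

theorem standardTrace_eq {ħ : ℝ} {a : rotationAlgebra ħ} {c : ℤ × ℤ → ℂ}
    (h : HasSum (fun p : ℤ × ℤ =>
      c p • (((bigU ħ ^ p.1 : unitary (BigProduct ħ)) : BigProduct ħ) *
        ((bigV ħ ^ p.2 : unitary (BigProduct ħ)) : BigProduct ħ))) (a : BigProduct ħ)) :
    standardTrace ħ a = c 0 := by
  have h1 := (hasSum_repOfPair (regularPair ħ) h).mapL
    ((innerSL ℂ unitCell) ∘L (ContinuousLinearMap.apply ℂ L2R unitCell))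
  have h2 : ∀ p, ((innerSL ℂ unitCell) ∘L (ContinuousLinearMap.apply ℂ L2R unitCell))
      (c p • monomialOp (regularPair ħ) p) = if p = 0 then c 0 else 0 := by
    intro p
    rw [map_smul]
    change c p • inner ℂ unitCell (monomialOp (regularPair ħ) p unitCell) = _
    rw [inner_unitCell_monomialOp]
    split_ifs with hp
    · simp [hp]
    · simp
  simp only [h2] at h1
  exact h1.unique (hasSum_ite_eq 0 (c 0))

/-! ### Abel sums of operators -/

theorem inner_eigenvector_of_ae {T : Op} {g : ℝ → ℂ} {q : ℝ} (k : ℕ)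
    (h : T (eigenvector k) =ᵐ[volume] fun x => g x * eigenvector k (x - q)) :
    inner ℂ (eigenvector k) (T (eigenvector k)) =
      ∫ x, g x * (eigenfunction k x * eigenfunction k (x - q)) := by
  have h0 : eigenvector k =ᵐ[volume] eigenfunction k := (eigenfunction k).coeFn_toLp 2 volume
  have h1 := (measurePreserving_sub_right (volume : Measure ℝ) q).quasiMeasurePreserving.ae h0
  rw [L2.inner_def]
  refine integral_congr_ae ?_
  filter_upwards [h, h0, h1] with x h2 h3 h4
  rw [h2, h3, h4, RCLike.inner_apply, conj_eigenfunction]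
  ring

theorem norm_inner_eigenvector_le (T : Op) (k : ℕ) :
    ‖inner ℂ (eigenvector k) (T (eigenvector k))‖ ≤ ‖T‖ := by
  refine (norm_inner_le_norm _ _).trans ?_
  have := T.le_opNorm (eigenvector k)
  simpa [norm_eigenvector] using this

/-- The functional `T ↦ ∑ t^k ⟨ψ_k, T ψ_k⟩`, for `0 ≤ t < 1`. -/
def abelFunctional (t : ℝ) : Op →L[ℂ] ℂ :=
  ∑' k : ℕ, (t : ℂ) ^ k •
    ((innerSL ℂ (eigenvector k)) ∘L (ContinuousLinearMap.apply ℂ L2R (eigenvector k)))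

/-- Because the `ψ_k` are unit vectors, the series of functionals converges in norm. The Abel sum is
therefore continuous in `T` and passes through norm-convergent sums of monomials. -/
theorem hasSum_abelFunctional {t : ℝ} (ht0 : 0 ≤ t) (ht1 : t < 1) (T : Op) :
    HasSum (fun k : ℕ => (t : ℂ) ^ k * inner ℂ (eigenvector k) (T (eigenvector k)))
      (abelFunctional t T) := by
  have hs : Summable fun k : ℕ => (t : ℂ) ^ k •
      ((innerSL ℂ (eigenvector k)) ∘L (ContinuousLinearMap.apply ℂ L2R (eigenvector k))) := by
    refine Summable.of_norm_bounded (summable_geometric_of_lt_one ht0 ht1) fun k => ?_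
    rw [norm_smul, norm_pow, Complex.norm_real, Real.norm_of_nonneg ht0]
    refine mul_le_of_le_one_right (by positivity) ?_
    refine ContinuousLinearMap.opNorm_le_bound _ zero_le_one fun T => ?_
    rw [one_mul]
    exact norm_inner_eigenvector_le T k
  exact hs.hasSum.mapL (ContinuousLinearMap.apply ℂ ℂ T)

theorem abelFunctional_eq_integral {t : ℝ} (ht0 : 0 ≤ t) (ht1 : t < 1) {T : Op} {g : ℝ → ℂ}
    {q C : ℝ} (hg : AEStronglyMeasurable g) (hC : ∀ x, ‖g x‖ ≤ C)
    (h : ∀ ξ, T ξ =ᵐ[volume] fun x => g x * ξ (x - q)) :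
    abelFunctional t T = ∫ x, g x * mehlerKernel t x (x - q) := by
  have h1 := hasSum_abelFunctional ht0 ht1 T
  simp only [fun k => inner_eigenvector_of_ae k (h (eigenvector k))] at h1
  exact h1.unique (hasSum_integral_mul_eigenfunction ht0 ht1 q hg hC)

/-- If the Abel sums of `T` are `O((1 - t)⁻¹ e^{-r / (1 - t)})`, then `Tr (T H^{-s})` extends to
an entire function. -/
theorem exists_entire_trace {T : Op} {r C : ℝ} (hr : 0 < r)
    (h : ∀ t : ℝ, 0 ≤ t → t < 1 →
      ‖abelFunctional t T‖ ≤ C * ((1 - t)⁻¹ * Real.exp (-(r / (1 - t))))) :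
    ∃ F : ℂ → ℂ, Differentiable ℂ F ∧ ∀ s : ℂ, 1 < s.re → HasSum (fun k : ℕ =>
      (2 * (k : ℂ) + 1) ^ (-s) * inner ℂ (eigenvector k) (T (eigenvector k))) (F s) :=
  exists_entire_of_abel_bound (norm_inner_eigenvector_le T) hr
    (fun _ ht0 ht1 => hasSum_abelFunctional ht0 ht1 T) h

theorem div_one_sub_le_mul_div {t r R : ℝ} (ht0 : 0 ≤ t) (ht1 : t < 1) (hr : 0 ≤ r)
    (hR : r ≤ R) : r / (1 - t) ≤ R * ((1 + t) / (1 - t)) := by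
  have h1 : 0 < 1 - t := by linarith
  rw [← mul_div_assoc]
  gcongr
  nlinarith

/-- The Gaussian integral with `p = 2πn`, `q = mħ`; its prefactor `e^{ipq/2}` has modulus one. -/
theorem norm_abelFunctional_monomialOp (ħ : ℝ) (p : ℤ × ℤ) {t : ℝ} (ht0 : 0 ≤ t) (ht1 : t < 1) :
    ‖abelFunctional t (monomialOp (heisenbergPair ħ) p)‖ =
      (1 - t)⁻¹ * Real.exp (-(((2 * Real.pi * p.1) ^ 2 + (p.2 * ħ) ^ 2) / 4 *
        ((1 + t) / (1 - t)))) := by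
  have h1 : 0 < 1 - t := by linarith
  have hphase : ∀ x : ℝ, exp (2 * Real.pi * (p.1 * x) * I) =
      exp (((2 * Real.pi * p.1 : ℝ) : ℂ) * x * I) := fun x => by
    push_cast
    ring_nf
  rw [abelFunctional_eq_integral (g := fun x : ℝ => exp (((2 * Real.pi * p.1 : ℝ) : ℂ) * x * I))
    (q := p.2 * ħ) (C := 1) ht0 ht1 (by fun_prop)
    (fun x => by rw [← Complex.ofReal_mul, Complex.norm_exp_ofReal_mul_I])
    (fun ξ => by
      simp only [← hphase]
      exact coeFn_monomialOp measurable_id (heisenbergPair ħ) rfl rfl p ξ),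
    integral_exp_mul_mehlerKernel ht0 ht1, norm_mul, Complex.norm_real,
    Real.norm_of_nonneg (by positivity)]
  have h2 : ((2 * Real.pi * p.1 : ℝ) : ℂ) * ((p.2 * ħ : ℝ) : ℂ) / 2 * I =
      ((2 * Real.pi * p.1 * (p.2 * ħ) / 2 : ℝ) : ℂ) * I := by
    push_cast
    rfl
  rw [h2, Complex.norm_exp_ofReal_mul_I, one_mul]

/-! ### Meromorphic continuation -/

/-- The residue of zeta makes the patched function continuous at `1`, so the singularity is
removable. -/
theorem exists_entire_sub_one_mul_zeta : ∃ Z : ℂ → ℂ, Differentiable ℂ Z ∧ Z 1 = 1 ∧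
    ∀ s, s ≠ 1 → Z s = (s - 1) * riemannZeta s := by
  refine ⟨Function.update (fun s => (s - 1) * riemannZeta s) 1 1, ?_, by simp,
    fun s hs => by rw [Function.update_of_ne hs]⟩
  have hdiff : ∀ s : ℂ, s ≠ 1 → DifferentiableAt ℂ
      (Function.update (fun s => (s - 1) * riemannZeta s) 1 1) s := by
    intro s hs
    refine (((differentiableAt_id.sub_const 1).mul
      (differentiableAt_riemannZeta hs)).congr_of_eventuallyEq ?_)
    filter_upwards [isOpen_ne.mem_nhds hs] with z hz
    rw [Function.update_of_ne hz]
    rfl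
  intro s
  by_cases hs : s = 1
  · subst hs
    refine (analyticAt_of_differentiable_on_punctured_nhds_of_continuousAt ?_ ?_).differentiableAt
    · filter_upwards [self_mem_nhdsWithin] with z hz
      exact hdiff z hz
    · exact continuousAt_update_same.mpr riemannZeta_residue_one
  · exact hdiff s hs

/-- A function with `F s = (s - 1)⁻¹ G s`, `G` entire, has at most a simple pole at `1`. -/
theorem meromorphic_of_sub_one_inv_mul {F G : ℂ → ℂ} (hG : Differentiable ℂ G)
    (hF : ∀ s, s ≠ 1 → F s = (s - 1)⁻¹ * G s) :
    MeromorphicOn F Set.univ ∧ AnalyticOnNhd ℂ F {1}ᶜ ∧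
      ((-1 : ℤ) : WithTop ℤ) ≤ meromorphicOrderAt F 1 ∧
      Tendsto (fun s => (s - 1) * F s) (𝓝[≠] 1) (𝓝 (G 1)) ∧
      (meromorphicOrderAt F 1 = ((-1 : ℤ) : WithTop ℤ) ↔ G 1 ≠ 0) := by
  have hGa : ∀ s, AnalyticAt ℂ G s := fun s => hG.analyticAt s
  have hinv : MeromorphicAt (fun s : ℂ => (s - 1)⁻¹) 1 := by fun_prop
  have hF1 : F =ᶠ[𝓝[≠] 1] (fun s => (s - 1)⁻¹) * G := by
    filter_upwards [self_mem_nhdsWithin] with s hs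
    exact hF s hs
  have hmer1 : MeromorphicAt F 1 := (hinv.mul (hGa 1).meromorphicAt).congr hF1.symm
  have hana : AnalyticOnNhd ℂ F {1}ᶜ := by
    intro s hs
    have hs' : s ≠ 1 := hs
    have h1 : AnalyticAt ℂ (fun s => (s - 1)⁻¹ * G s) s :=
      ((analyticAt_id.sub analyticAt_const).inv (sub_ne_zero.mpr hs')).mul (hGa s)
    refine h1.congr ?_
    filter_upwards [isOpen_ne.mem_nhds hs'] with z hz
    exact (hF z hz).symm
  have hord : meromorphicOrderAt F 1 = ((-1 : ℤ) : WithTop ℤ) + meromorphicOrderAt G 1 := by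
    rw [meromorphicOrderAt_congr hF1, meromorphicOrderAt_mul hinv (hGa 1).meromorphicAt]
    congr 1
    rw [meromorphicOrderAt_eq_int_iff hinv]
    refine ⟨fun _ => 1, analyticAt_const, one_ne_zero, ?_⟩
    filter_upwards with s
    simp
  have hG0 : 0 ≤ meromorphicOrderAt G 1 := (hGa 1).meromorphicOrderAt_nonneg
  refine ⟨fun s _ => ?_, hana, ?_, ?_, ?_⟩
  · by_cases hs : s = 1
    · exact hs ▸ hmer1
    · exact (hana s hs).meromorphicAt
  · rw [hord]
    exact le_add_of_nonneg_right hG0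
  · have h1 : Tendsto G (𝓝[≠] 1) (𝓝 (G 1)) := (hG 1).continuousAt.continuousWithinAt
    refine h1.congr' ?_
    filter_upwards [self_mem_nhdsWithin] with s hs
    rw [hF s hs, mul_inv_cancel_left₀ (sub_ne_zero.mpr hs)]
  -- The order of `F` is that of `G` minus one, so it equals `-1` exactly when `G` has order `0`.
  · rw [hord, (hGa 1).meromorphicOrderAt_eq, ← (hGa 1).analyticOrderAt_eq_zero]
    generalize analyticOrderAt G 1 = n
    cases n with
    | top =>
      have h : (⊤ : WithTop ℤ) ≠ ((-1 : ℤ) : WithTop ℤ) := WithTop.top_ne_coe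
      simpa using h
    | coe n =>
      norm_cast
      simp

/-- The scalar part and the remainder of `∑ c_{nm} u^n v^m`. -/
theorem exists_trace_continuation (ħ : ℝ) (S : Set (ℤ × ℤ))
    (hS : ∀ p, p ∈ S ↔ p.1 = 0 ∧ p.2 * ħ = 0) {c : ℤ × ℤ → ℂ} (hc : Summable fun p => ‖c p‖)
    {T : Op} (hT : HasSum (fun p => c p • monomialOp (heisenbergPair ħ) p) T) :
    ∃ F : ℂ → ℂ, Differentiable ℂ F ∧ ∀ s : ℂ, 1 < s.re →
      HasTrace (T * oscillatorPow s)
        ((∑' p, S.indicator c p) * ((1 - 2 ^ (-s)) * riemannZeta s) + F s) := by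
  have hone : ∀ p ∈ S, monomialOp (heisenbergPair ħ) p = 1 := by
    intro p hp
    obtain ⟨h1, h2⟩ := (hS p).mp hp
    refine ContinuousLinearMap.ext fun ξ => Lp.ext ?_
    filter_upwards [coeFn_monomialOp measurable_id (heisenbergPair ħ) rfl rfl p ξ] with x hx
    rw [hx, h1, h2]
    simp
  -- One decay rate for all monomials outside `S`: `π² n² ≥ 1` if `n ≠ 0`, and otherwise `m²ħ²/4 ≥
  -- ħ²/4`. For `ħ = 0` the second case lies in `S`.
  obtain ⟨r, hr, hrle⟩ : ∃ r : ℝ, 0 < r ∧ ∀ p ∉ S,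
      r ≤ ((2 * Real.pi * p.1) ^ 2 + (p.2 * ħ) ^ 2) / 4 := by
    have hinteg : ∀ n : ℤ, n ≠ 0 → (1 : ℝ) ≤ (n : ℝ) ^ 2 := fun n hn => by
      have h : (1 : ℤ) ≤ n ^ 2 := by
        have := pow_pos (abs_pos.mpr hn) 2
        rw [sq_abs] at this
        omega
      exact_mod_cast h
    have hpi := Real.pi_gt_three
    by_cases hħ : ħ = 0
    · refine ⟨1, one_pos, fun p hp => ?_⟩
      have hn : p.1 ≠ 0 := fun h => hp ((hS p).mpr ⟨h, by simp [hħ]⟩)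
      have h1 := hinteg _ hn
      rw [mul_pow]
      nlinarith [sq_nonneg (p.2 * ħ)]
    · refine ⟨min 1 (ħ ^ 2 / 4), by positivity, fun p hp => ?_⟩
      by_cases hn : p.1 = 0
      · have hm : p.2 ≠ 0 := fun h => hp ((hS p).mpr ⟨hn, by simp [h]⟩)
        have h1 := hinteg _ hm
        refine (min_le_right _ _).trans ?_
        rw [hn, mul_pow]
        simp only [Int.cast_zero]
        nlinarith [sq_nonneg ħ]
      · have h1 := hinteg _ hn
        refine (min_le_left _ _).trans ?_
        rw [mul_pow]
        nlinarith [sq_nonneg (p.2 * ħ)]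
  set C₀ : ℂ := ∑' p, S.indicator c p with hC₀
  have hscalar : HasSum (fun p => S.indicator c p • monomialOp (heisenbergPair ħ) p)
      (C₀ • (1 : Op)) := by
    have h1 : HasSum (S.indicator c) C₀ := (hc.of_norm.indicator S).hasSum
    convert! h1.smul_const (1 : Op) using 2 with p
    by_cases hp : p ∈ S
    · rw [hone p hp]
    · rw [Set.indicator_of_notMem hp, zero_smul, zero_smul]
  have hrest := hT.sub hscalar
  -- With the scalar part removed, the termwise bounds share the same `r` and add up to `∑ ‖c p‖`
  -- times the common bound.
  obtain ⟨F, hF, hFs⟩ := exists_entire_trace (T := T - C₀ • (1 : Op)) hr (C := ∑' p, ‖c p‖)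
    (fun t ht0 ht1 => by
      have h1 := hrest.mapL (abelFunctional t)
      have h0 : 0 < 1 - t := by linarith
      refine (h1.norm_le_of_bounded (hc.hasSum.mul_right _) fun p => ?_)
      rw [← sub_smul, map_smul, norm_smul]
      by_cases hp : p ∈ S
      · rw [Set.indicator_of_mem hp, sub_self, norm_zero, zero_mul]
        positivity
      · rw [Set.indicator_of_notMem hp, sub_zero, norm_abelFunctional_monomialOp ħ p ht0 ht1]
        gcongr
        exact div_one_sub_le_mul_div ht0 ht1 hr.le (hrle p hp))
  refine ⟨F, hF, fun s hs => hasTrace_mul_oscillatorPow T hs ?_⟩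
  convert! ((hasSum_odd_zeta hs).mul_left C₀).add (hFs s hs) using 2 with k
  rw [sub_apply, inner_sub_right]
  change _ = _ + _ * (_ - inner ℂ (eigenvector k) (C₀ • eigenvector k))
  rw [inner_smul_right, inner_eigenvector_self]
  ring

end Heisenberg

end

/-! ### Assembly of the two continuation statements -/

theorem mainTheorem5 :
    (∀ (ħ : ℝ), ∀ a ∈ Heisenberg.schwartzAlgebra ħ, ∃ F : ℂ → ℂ,
      (∀ s : ℂ, 1 < s.re →
        Heisenberg.HasTrace (Heisenberg.heisenbergRep ħ a * Heisenberg.oscillatorPow s) (F s)) ∧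
      MeromorphicOn F Set.univ ∧
      AnalyticOnNhd ℂ F {1}ᶜ ∧
      ((-1 : ℤ) : WithTop ℤ) ≤ meromorphicOrderAt F 1 ∧
      (ħ ≠ 0 →
        Tendsto (fun s => (s - 1) * F s) (𝓝[≠] 1) (𝓝 (Heisenberg.standardTrace ħ a / 2)) ∧
        (meromorphicOrderAt F 1 = ((-1 : ℤ) : WithTop ℤ) ↔ Heisenberg.standardTrace ħ a ≠ 0))) ∧
    (∀ f : BoundedContinuousFunction ℝ ℂ, UniformContinuous f → ∀ α : ℝ, α ≠ 0 →
      ∃ F : ℂ → ℂ, Differentiable ℂ F ∧ ∀ s : ℂ, 1 < s.re →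
        Heisenberg.HasTrace
          (Heisenberg.mulOp (fun x => f x) (Heisenberg.memLp_boundedContinuous f) *
            ((Heisenberg.translation α).toContinuousLinearEquiv : Heisenberg.Op) *
            Heisenberg.oscillatorPow s) (F s)) := by
  open Heisenberg in
  refine ⟨fun ħ a ha => ?_, fun f _ α hα => ?_⟩
  · obtain ⟨c, hc, hsum⟩ := ha
    have hc0 : Summable fun p => ‖c p‖ := by simpa using hc 0
    set S : Set (ℤ × ℤ) := {p | p.1 = 0 ∧ p.2 * ħ = 0} with hS
    obtain ⟨F, hF, hFs⟩ := exists_trace_continuation ħ S (fun p => Iff.rfl) hc0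
      (hasSum_repOfPair (heisenbergPair ħ) hsum)
    obtain ⟨Z, hZ, hZ1, hZs⟩ := exists_entire_sub_one_mul_zeta
    set C₀ : ℂ := ∑' p, S.indicator c p with hC₀
    have hpow : Differentiable ℂ fun s : ℂ => (2 : ℂ) ^ (-s) := by
      intro s
      exact (differentiableAt_id.neg).const_cpow (Or.inl two_ne_zero)
    have hG : Differentiable ℂ fun s => C₀ * ((1 - 2 ^ (-s)) * Z s) + (s - 1) * F s := by
      fun_prop
    -- The value that `riemannZeta` takes at `1` plays no role: the identity with `(s - 1)⁻¹ G(s)`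
    -- is required only for `s ≠ 1`.
    obtain ⟨h1, h2, h3, h4, h5⟩ := meromorphic_of_sub_one_inv_mul
      (F := fun s => C₀ * ((1 - 2 ^ (-s)) * riemannZeta s) + F s) hG (fun s hs => by
        have := sub_ne_zero.mpr hs
        rw [hZs s hs]
        field_simp)
    refine ⟨_, hFs, h1, h2, h3, fun hħ => ?_⟩
    have hτ : standardTrace ħ a = C₀ := by
      rw [standardTrace_eq hsum, hC₀, tsum_eq_single 0]
      · rw [Set.indicator_of_mem (by simp [hS])]
      · intro p hp
        refine Set.indicator_of_notMem (fun hpS => hp ?_) c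
        exact Prod.ext hpS.1 (by simpa [hħ] using hpS.2)
    -- The factor `1 - 2^{-1} = 1/2` is the residue of the odd zeta series.
    have hG1 : C₀ * ((1 - 2 ^ (-(1 : ℂ))) * Z 1) + ((1 : ℂ) - 1) * F 1 = standardTrace ħ a / 2 := by
      rw [hτ, hZ1, Complex.cpow_neg_one]
      ring
    simp only [hG1] at h4 h5
    exact ⟨h4, by simpa using h5⟩
  · obtain ⟨F, hF, hFs⟩ := exists_entire_trace
      (T := mulOp (fun x => f x) (memLp_boundedContinuous f) *
        ((translation α).toContinuousLinearEquiv : Op)) (r := α ^ 2 / 4) (C := ‖f‖)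
      (by positivity) (fun t ht0 ht1 => by
        have h0 : 0 < 1 - t := by linarith
        rw [abelFunctional_eq_integral (g := fun x => f x) (q := α) ht0 ht1
          f.continuous.aestronglyMeasurable f.norm_coe_le_norm (fun ξ => by
            change mulOp _ (memLp_boundedContinuous f) (translation α ξ) =ᵐ[volume] _
            filter_upwards [coeFn_mulOp _ (memLp_boundedContinuous f) (translation α ξ),
              coeFn_translation α ξ] with x h1 h2
            rw [h1, h2])]
        refine (norm_integral_mul_mehlerKernel_le ht0 ht1 α f.norm_coe_le_norm).trans ?_
        gcongr
        exact div_one_sub_le_mul_div ht0 ht1 (by positivity) le_rfl)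
    exact ⟨F, hF, fun s hs => hasTrace_mul_oscillatorPow _ hs (hFs s hs)⟩
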